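/- Let $0\le n<N$, let $U\subset\mathbb R^N$ be open (for instance $U=\mathbb R^N$), and let $\Sigma$ be a proper $n$-dimensional rectifiable varifold in $U$, i.e. a Radon measure $\mu_\Sigma$ on $U$ which at $\mu_\Sigma$-almost every point $x$ has an $n$-dimensional approximate tangent plane $T_x\Sigma$ with positive multiplicity. Write $\int_\Sigma f$ for $\int f\,d\mu_\Sigma$. Assume that $\Sigma$ is $F$-stationary in $U$, i.e. the first variation of the Gaussian area $F(\Sigma)=(4\pi)^{-n/2}\int_\Sigma e^{-|x|^2/4}$ vanishes: $$\int_\Sigma\Big(\operatorname{div}_{T_x\Sigma}X-\tfrac12\langle x,X\rangle\Big)e^{-|x|^2/4}=0\qquad\text{for all } X\in C^1_c(U;\mathbb R^N).$$ Let $\mathrm{Reg}(\Sigma)$ be the set of points of the support of $\Sigma$ in $U$ near which the support is a smooth embedded $n$-dimensional submanifold. On normal vector fields $\eta$ along $\mathrm{Reg}(\Sigma)$ let $$L\eta=\Delta^\perp\eta-\tfrac12\nabla^\perp_{x^T}\eta+\sum_{i,j}\langle A(f_i,f_j),\eta\rangle A(f_i,f_j)+\tfrac12\eta,$$ where $A$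 is the second fundamental form, $f_i$ is an orthonormal basis of the tangent space, and $\nabla^\perp,\Delta^\perp$ are the connection and Laplacian of the normal bundle. Assume that $\Sigma$ is Gaussian stable, i.e. $$\int_\Sigma\langle\eta,L\eta\rangle\,e^{-|x|^2/4}\le0$$ for every smooth normal vector field $\eta$ with compact support in $\mathrm{Reg}(\Sigma)$. Then every locally Lipschitz function $w:\mathrm{Reg}(\Sigma)\to\mathbb R$ with compact support in $\mathrm{Reg}(\Sigma)$, extended by zero, satisfies $$\int_\Sigma w^2e^{-|x|^2/4}\le2\int_\Sigma|\nabla w|^2e^{-|x|^2/4},$$ where $\nabla w$ is the (almost everywhere defined) gradient of $w$ on $\mathrm{Reg}(\Sigma)$. -/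

import Mathlib

open MeasureTheory Filter Topology
open scoped ContDiff

noncomputable section

namespace GaussianVarifold

/-- Euclidean space `ℝ^N`. -/
abbrev Euc (N : ℕ) : Type := EuclideanSpace ℝ (Fin N)

variable {N n : ℕ} {U : Set (Euc N)}

/-! ### Rectifiable varifolds -/

/-- The linear subspace `P` is an `n`-dimensional approximate tangent plane of the measure `μ` at
`x`, with multiplicity `θ > 0`: the rescalings of `μ` around `x` converge weakly to `θ` times the
`n`-dimensional Hausdorff measure on `P`, that is
`r⁻ⁿ ∫ f ((y - x) / r) dμ(y) → θ ∫_P f dℋⁿ` as `r ↓ 0`, for all continuous compactly supported `f`.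
The integral over `P` is written through a linear isometry of `ℝⁿ` onto `P`. -/
def HasApproxTangentPlane (n : ℕ) (μ : Measure (Euc N)) (x : Euc N) (θ : ℝ)
    (P : Submodule ℝ (Euc N)) : Prop :=
  0 < θ ∧ ∃ i : Euc n →ₗᵢ[ℝ] Euc N, LinearMap.range i.toLinearMap = P ∧
    ∀ f : Euc N → ℝ, Continuous f → HasCompactSupport f →
      Tendsto (fun r : ℝ => (r ^ n)⁻¹ * ∫ y, f (r⁻¹ • (y - x)) ∂μ) (𝓝[>] 0)
        (𝓝 (θ * ∫ z : Euc n, f (i z)))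

/-- An `n`-dimensional rectifiable varifold in the open set `U ⊆ ℝ^N`, given by its weight measure:
a Radon measure on `U` (stored as a measure on `ℝ^N` that does not charge the complement of `U`)
which has an `n`-dimensional approximate tangent plane with positive multiplicity at almost every
point. Such measures are exactly `θ ℋⁿ ⌞ M` with `M` countably `n`-rectifiable and `θ > 0` locally
integrable on `M`, and the varifold is determined by its weight.
Being Radon on `U`, the varifold is proper in `U`: its support is relatively closed in `U` and every
compact subset of `U` has finite mass. -/
structure RectifiableVarifold (N n : ℕ) (U : Set (Euc N)) where
  /-- The weight measure; `∫_Σ f` is the integral of `f` against it. -/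
  weight : Measure (Euc N)
  weight_compl : weight Uᶜ = 0
  weight_lt_top : ∀ K : Set (Euc N), IsCompact K → K ⊆ U → weight K < ⊤
  ae_tangent : ∀ᵐ x ∂weight, ∃ (P : Submodule ℝ (Euc N)) (θ : ℝ),
    HasApproxTangentPlane n weight x θ P

namespace RectifiableVarifold

open Classical in
/-- The approximate tangent plane (it exists, and is then unique, almost everywhere). -/
def approxTangentPlane (V : RectifiableVarifold N n U) (x : Euc N) : Submodule ℝ (Euc N) :=
  if h : ∃ (P : Submodule ℝ (Euc N)) (θ : ℝ), HasApproxTangentPlane n V.weight x θ P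
  then h.choose else ⊥

/-- The support of the varifold in `U`. -/
def spt (V : RectifiableVarifold N n U) : Set (Euc N) :=
  {x | x ∈ U ∧ ∀ W ∈ 𝓝 x, 0 < V.weight W}

end RectifiableVarifold

/-- Divergence of the vector field `X` along the subspace `P`: `∑ⱼ ⟨fⱼ, D_{fⱼ} X⟩` for an
orthonormal basis `fⱼ` of `P`, which is the trace of `π_P ∘ DX`. -/
def divAlong (P : Submodule ℝ (Euc N)) (X : Euc N → Euc N) (x : Euc N) : ℝ :=
  LinearMap.trace ℝ (Euc N) (P.starProjection.comp (fderiv ℝ X x)).toLinearMap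

/-- `V` is `F`-stationary in `U`: the first variation of the Gaussian area
`F(V) = (4π)^(-n/2) ∫ e^{-|x|²/4} d‖V‖` vanishes along every compactly supported `C¹` vector field
in `U`. The derivative of `F` along the deformation generated by `X` is, up to the factor
`(4π)^(-n/2)`, equal to `∫ (div_{T_xV} X - ½ ⟨x, X⟩) e^{-|x|²/4} d‖V‖`. -/
def RectifiableVarifold.IsFStationary (V : RectifiableVarifold N n U) : Prop :=
  ∀ X : Euc N → Euc N, ContDiff ℝ 1 X → HasCompactSupport X → tsupport X ⊆ U →
    ∫ x, (divAlong (V.approxTangentPlane x) X x - (1 / 2) * inner ℝ x (X x))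
      * Real.exp (-‖x‖ ^ 2 / 4) ∂V.weight = 0

/-! ### The regular set -/

/-- Near `x ∈ S`, the set `S` is a smooth embedded `n`-dimensional submanifold of `ℝ^N`: a smooth
diffeomorphism between open sets, the first one containing `x`, carries `S` to an `n`-plane. -/
def IsEmbeddedSubmanifoldAt (n : ℕ) (S : Set (Euc N)) (x : Euc N) : Prop :=
  x ∈ S ∧ ∃ (φ : OpenPartialHomeomorph (Euc N) (Euc N)) (P : Submodule ℝ (Euc N)),
    x ∈ φ.source ∧ ContDiffOn ℝ ∞ φ φ.source ∧ ContDiffOn ℝ ∞ φ.symm φ.target ∧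
    Module.finrank ℝ P = n ∧ ∀ y ∈ φ.source, (y ∈ S ↔ φ y ∈ P)

/-- The regular set: the points of the support near which the support is a smooth embedded
`n`-dimensional submanifold. -/
def RectifiableVarifold.reg (V : RectifiableVarifold N n U) : Set (Euc N) :=
  {x | IsEmbeddedSubmanifoldAt n V.spt x}

/-! ### Geometry of a submanifold `M` of `ℝ^N`

Functions and vector fields on `M` are represented by functions on `ℝ^N`, of which only the values
on `M` matter; derivatives are taken within `M`, and are only evaluated on tangent vectors of `M`,
where they do not depend on the choice made by `fderivWithin`. -/

section Submanifold

variable (M : Set (Euc N))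

/-- The tangent space `T_xM`. -/
def tangentSpaceAt (x : Euc N) : Submodule ℝ (Euc N) :=
  Submodule.span ℝ (tangentConeAt ℝ M x)

/-- The tangential part `v^T` of `v` at `x`. -/
def tanPart (x v : Euc N) : Euc N := (tangentSpaceAt M x).starProjection v

/-- The normal part `v^⊥` of `v` at `x`. -/
def norPart (x v : Euc N) : Euc N := (tangentSpaceAt M x)ᗮ.starProjection v

/-- The gradient on `M` of the function `w`. -/
def gradAt (w : Euc N → ℝ) (x : Euc N) : Euc N :=
  tanPart M x ((InnerProductSpace.toDual ℝ (Euc N)).symm (fderivWithin ℝ w M x))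

/-- The Levi-Civita connection `∇_u Y` for a tangential field `Y` and `u ∈ T_xM`. -/
def tanConn (Y : Euc N → Euc N) (x u : Euc N) : Euc N :=
  tanPart M x (fderivWithin ℝ Y M x u)

/-- The normal connection `∇^⊥_u η` for a normal field `η` and `u ∈ T_xM`. -/
def norConn (η : Euc N → Euc N) (x u : Euc N) : Euc N :=
  norPart M x (fderivWithin ℝ η M x u)

/-- The second fundamental form `A(u, v) = (D_u Y)^⊥`, for `u, v ∈ T_xM`, where `Y` is the
tangential extension `y ↦ v^T` of `v`. -/
def secondFF (x u v : Euc N) : Euc N :=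
  norPart M x (fderivWithin ℝ (fun y => tanPart M y v) M x u)

/-- The second covariant derivative `∇^⊥_u ∇^⊥_Y η - ∇^⊥_{∇_u Y} η` of the normal field `η`, for
`u, v ∈ T_xM`, where `Y` is the tangential extension `y ↦ v^T` of `v`. -/
def norHess (η : Euc N → Euc N) (x u v : Euc N) : Euc N :=
  norConn M (fun y => norConn M η y (tanPart M y v)) x u
    - norConn M η x (tanConn M (fun y => tanPart M y v) x u)

/-- An orthonormal basis of `T_xM`. -/
def frame (x : Euc N) (i : Fin (Module.finrank ℝ (tangentSpaceAt M x))) : Euc N :=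
  (stdOrthonormalBasis ℝ (tangentSpaceAt M x) i : Euc N)

/-- The Laplacian `Δ^⊥` of the normal bundle. -/
def norLaplacian (η : Euc N → Euc N) (x : Euc N) : Euc N :=
  ∑ i, norHess M η x (frame M x i) (frame M x i)

/-- The drift Laplacian `ℒ η = Δ^⊥ η - ½ ∇^⊥_{x^T} η` on normal fields. -/
def driftLaplacian (η : Euc N → Euc N) (x : Euc N) : Euc N :=
  norLaplacian M η x - (1 / 2 : ℝ) • norConn M η x (tanPart M x x)

/-- The second variation operator of Gaussian area,
`L η = ℒ η + ∑ᵢⱼ ⟨A(fᵢ, fⱼ), η⟩ A(fᵢ, fⱼ) + ½ η`. -/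
def secondVariation (η : Euc N → Euc N) (x : Euc N) : Euc N :=
  driftLaplacian M η x
    + ∑ i, ∑ j, (inner ℝ (secondFF M x (frame M x i) (frame M x j)) (η x) : ℝ) •
        secondFF M x (frame M x i) (frame M x j)
    + (1 / 2 : ℝ) • η x

end Submanifold

/-- Gaussian stability: `∫_Σ ⟨η, L η⟩ e^{-|x|²/4} ≤ 0` for every smooth normal vector field `η` with
compact support on the regular set. -/
def RectifiableVarifold.IsGaussianStable (V : RectifiableVarifold N n U) : Prop :=
  ∀ η : Euc N → Euc N, ContDiffOn ℝ ∞ η V.reg →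
    (∀ x ∈ V.reg, η x ∈ (tangentSpaceAt V.reg x)ᗮ) →
    HasCompactSupport η → tsupport η ⊆ V.reg →
    ∫ x, inner ℝ (η x) (secondVariation V.reg η x) * Real.exp (-‖x‖ ^ 2 / 4) ∂V.weight ≤ 0

end GaussianVarifold

end

open MeasureTheory Filter Topology
open scoped ContDiff

noncomputable section

namespace GaussianVarifold

variable {N n : ℕ} {U : Set (Euc N)}

/-! For smooth `u`, stability is tested with the normal fields `ηᵢ = u eᵢ^⊥`, where `eᵢ` runs over
the standard basis of `ℝ^N`, and the results are added. Three pointwise facts make the sum explicit: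
`∑ |ηᵢ|² = (N - n) u²`; `∑ |∇^⊥_a ηᵢ|² = (N - n) (∂_a u)² + u² |A(a, ·)|²`; and `∑ᵢ ⟨A, ηᵢ⟩²` has
trace `u² |A|²`. The two curvature terms cancel. With `X = u ∇u` this leaves
(`sum_stabilityDensity`) `∑ ⟨ηᵢ, L ηᵢ⟩ = (N - n) (div X - ½ ⟨x, X⟩ - |∇u|² + ½ u²)`. Stationarity
tested with `X` itself removes the first two terms after integration. What remains is `½ ∫ u² ≤ ∫
|∇u|²`, because `N - n > 0`. Neither the mean curvature equation nor a divergence theorem on the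
regular set is needed.

To have ambient test fields and ordinary derivatives, the tangential projection is extended to a
smooth map `p` on `ℝ^N` (`exists_isTangentProjection`). The intrinsic operators are rewritten in
terms of `p`, and every identity valid on the submanifold is differentiated in tangent directions
only. Stationarity involves the approximate tangent plane, which at almost every regular point is
the classical tangent space (`approxTangentPlane_eq`).

A Lipschitz `w` is reached by mollifying an ambient Lipschitz extension `f`. Since the weight is
`n`-dimensional, Lebesgue-a.e. convergence of gradients in `ℝ^N` would not suffice. Instead `f` is
made constant along the fibres of chart projections, up to a partition of unity. Rademacher in `ℝⁿ`,
combined with the absolute continuity of the weight in charts (`weight_coord_preimage_eq_zero`),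
then gives differentiability weight-a.e., and `tendsto_fderiv_mollify` gives convergence at each
such point. -/

/-! ### Sums over orthonormal bases of a subspace -/

/-- The standard orthonormal basis of `ℝ^N`. -/
def stdBasis (N : ℕ) : OrthonormalBasis (Fin N) ℝ (Euc N) :=
  EuclideanSpace.basisFun (Fin N) ℝ

/-- The trace of `B` over `T` does not depend on the spanning system, by Parseval for the
coefficients `⟨f i, e k⟩`. It replaces orthonormal frames, which need not vary smoothly, by the
projected vectors `p y (e k)`, which do. -/
lemma sum_bilin_orthonormalBasis {ι : Type*} [Fintype ι] (T : Submodule ℝ (Euc N))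
    (f : OrthonormalBasis ι ℝ T) (B : Euc N →ₗ[ℝ] Euc N →ₗ[ℝ] ℝ) :
    ∑ j, B (f j) (f j) =
      ∑ k, B (T.starProjection (stdBasis N k)) (T.starProjection (stdBasis N k)) := by
  have h (k : Fin N) : T.starProjection (stdBasis N k)
      = ∑ j, inner ℝ (f j : Euc N) (stdBasis N k) • (f j : Euc N) := by
    have := f.sum_repr' (T.orthogonalProjectionOnto (stdBasis N k))
    rw [Submodule.starProjection_apply, ← this]
    simp
  have h2 (i j : ι) : ∑ k, inner ℝ (f i : Euc N) (stdBasis N k)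
      * inner ℝ (f j : Euc N) (stdBasis N k) = inner ℝ (f i) (f j) := by
    rw [Submodule.coe_inner, ← (stdBasis N).sum_inner_mul_inner]
    exact Finset.sum_congr rfl fun k _ => by rw [real_inner_comm (f j : Euc N)]
  classical
  simp only [h, map_sum, map_smul, LinearMap.sum_apply, LinearMap.smul_apply, smul_eq_mul,
    Finset.mul_sum]
  rw [Finset.sum_comm]
  simp_rw [Finset.sum_comm (s := (Finset.univ : Finset (Fin N)))]
  have h3 (i j : ι) : ∑ k, inner ℝ (f i : Euc N) (stdBasis N k) * (inner ℝ (f j : Euc N)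
      (stdBasis N k) * B (f j) (f i)) = if i = j then B (f j) (f i) else 0 := by
    simp_rw [← mul_assoc]
    rw [← Finset.sum_mul, h2, orthonormal_iff_ite.1 f.orthonormal]
    simp
  simp_rw [h3]
  simp

/-- Idempotence supplies a second projection, and cyclicity of the trace moves it to the other side
of `A`. -/
lemma trace_starProjection_comp (T : Submodule ℝ (Euc N)) (A : Euc N →L[ℝ] Euc N) :
    LinearMap.trace ℝ (Euc N) (T.starProjection.comp A).toLinearMap =
      ∑ k, inner ℝ (T.starProjection (stdBasis N k))
        (A (T.starProjection (stdBasis N k))) := by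
  have h1 : (T.starProjection.comp A).toLinearMap
      = T.starProjection.toLinearMap * (T.starProjection.comp A).toLinearMap := by
    ext v : 1
    simp [Submodule.starProjection_eq_self_iff.2 (T.starProjection_apply_mem (A v))]
  rw [h1, LinearMap.trace_mul_comm, LinearMap.trace_eq_sum_inner _ (stdBasis N)]
  refine Finset.sum_congr rfl fun k _ => ?_
  simp only [Module.End.mul_apply, ContinuousLinearMap.coe_coe, ContinuousLinearMap.comp_apply]
  rw [T.inner_starProjection_left_eq_right]

lemma sum_norm_sq_starProjection (T : Submodule ℝ (Euc N)) :
    ∑ k, ‖T.starProjection (stdBasis N k)‖ ^ 2 = Module.finrank ℝ T := by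
  refine Eq.trans (Finset.sum_congr rfl fun k _ => ?_)
    ((sum_bilin_orthonormalBasis T (stdOrthonormalBasis ℝ T) (innerₗ (Euc N))).symm.trans ?_)
  · exact (real_inner_self_eq_norm_sq _).symm
  · refine (Finset.sum_congr rfl fun k _ => real_inner_self_eq_norm_sq
      (stdOrthonormalBasis ℝ T k : Euc N)).trans ?_
    have h (k) : ‖(stdOrthonormalBasis ℝ T k : Euc N)‖ = 1 :=
      (stdOrthonormalBasis ℝ T).norm_eq_one k
    rw [Finset.sum_congr rfl fun k _ => by rw [h k]]
    simp

lemma sum_norm_sq_sub_starProjection (T : Submodule ℝ (Euc N)) :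
    ∑ k, ‖stdBasis N k - T.starProjection (stdBasis N k)‖ ^ 2 = N - Module.finrank ℝ T := by
  have h (k : Fin N) : ‖stdBasis N k - T.starProjection (stdBasis N k)‖ ^ 2
      = 1 - ‖T.starProjection (stdBasis N k)‖ ^ 2 := by
    have := Submodule.norm_sq_eq_add_norm_sq_starProjection (stdBasis N k) T
    rw [Submodule.starProjection_orthogonal_val, (stdBasis N).norm_eq_one] at this
    linarith
  rw [Finset.sum_congr rfl fun k _ => h k, Finset.sum_sub_distrib, sum_norm_sq_starProjection]
  simp

/-! ### Derivatives within a set along its tangent spaces -/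

/-- Derivatives within `M` are not unique, but any two agree on the tangent cone and hence on its
span. So the value chosen by `fderivWithin` on a tangent vector can be computed from any ambient
differentiable extension. -/
lemma fderivWithin_apply_of_mem_tangentSpaceAt {F : Type*} [NormedAddCommGroup F]
    [NormedSpace ℝ F] {M : Set (Euc N)} {G H : Euc N → F} {x a : Euc N} (hx : x ∈ M)
    (hGH : G =ᶠ[𝓝[M] x] H) (hH : DifferentiableAt ℝ H x) (ha : a ∈ tangentSpaceAt M x) :
    fderivWithin ℝ G M x a = fderiv ℝ H x a := by
  have h1 : HasFDerivWithinAt G (fderiv ℝ H x) M x :=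
    hH.hasFDerivAt.hasFDerivWithinAt.congr_of_eventuallyEq hGH (hGH.eq_of_nhdsWithin hx)
  have h2 := h1.differentiableWithinAt.hasFDerivWithinAt
  have h3 : tangentSpaceAt M x ≤ LinearMap.eqLocus (fderivWithin ℝ G M x).toLinearMap
      (fderiv ℝ H x).toLinearMap := Submodule.span_le.2 (h2.unique_on h1)
  exact h3 ha

lemma fderiv_apply_eq_of_mem_tangentSpaceAt {F : Type*} [NormedAddCommGroup F]
    [NormedSpace ℝ F] {M : Set (Euc N)} {G H : Euc N → F} {x a : Euc N} (hx : x ∈ M)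
    (hGH : G =ᶠ[𝓝[M] x] H) (hG : DifferentiableAt ℝ G x) (hH : DifferentiableAt ℝ H x)
    (ha : a ∈ tangentSpaceAt M x) : fderiv ℝ G x a = fderiv ℝ H x a := by
  rw [← fderivWithin_apply_of_mem_tangentSpaceAt hx hGH hH ha,
    ← fderivWithin_apply_of_mem_tangentSpaceAt hx (EventuallyEq.refl _ _) hG ha]

/-! ### The second variation in terms of an ambient extension of the tangential projection -/

/-- `p` is a smooth map on `ℝ^N` which on `M ∩ O` is the projection onto the tangent space. -/
structure IsTangentProjection (M O : Set (Euc N)) (p : Euc N → Euc N →L[ℝ] Euc N) : Prop where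
  contDiff : ContDiff ℝ ∞ p
  isOpen : IsOpen O
  eq_starProjection : ∀ y ∈ M ∩ O, p y = (tangentSpaceAt M y).starProjection

/-- The differential of the normal field `η`, restricted to tangent vectors and projected to the
normal space by means of the extension `p` of the tangential projection. -/
def normalDeriv (p : Euc N → Euc N →L[ℝ] Euc N) (η : Euc N → Euc N) (y : Euc N) :
    Euc N →L[ℝ] Euc N :=
  ((ContinuousLinearMap.id ℝ (Euc N)) - p y) ∘L (fderiv ℝ η y) ∘L (p y)

/-- The quadratic form of the second variation in terms of ambient derivatives. -/
def stabilityDensity (p : Euc N → Euc N →L[ℝ] Euc N) (η : Euc N → Euc N) (x : Euc N) : ℝ :=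
  ∑ k, inner ℝ (η x) (fderiv ℝ (normalDeriv p η) x (p x (stdBasis N k)) (p x (stdBasis N k)))
    - (1 / 2) * inner ℝ (η x) (fderiv ℝ η x (p x x))
    + ∑ k, ∑ l, inner ℝ (fderiv ℝ p x (p x (stdBasis N k)) (p x (stdBasis N l))) (η x) ^ 2
    + (1 / 2) * ‖η x‖ ^ 2

section

variable {M O : Set (Euc N)} {p : Euc N → Euc N →L[ℝ] Euc N} {η : Euc N → Euc N} {x a b : Euc N}

lemma contDiff_normalDeriv (hp : ContDiff ℝ ∞ p) (hη : ContDiff ℝ ∞ η) :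
    ContDiff ℝ ∞ (normalDeriv p η) := by
  have h : ContDiff ℝ ∞ (fderiv ℝ η) := hη.fderiv_right (m := ∞) (by simp)
  exact (contDiff_const.sub hp).clm_comp (h.clm_comp hp)

namespace IsTangentProjection

lemma mem_nhdsWithin (hp : IsTangentProjection M O p) (hx : x ∈ M ∩ O) : M ∩ O ∈ 𝓝[M] x :=
  Filter.inter_mem self_mem_nhdsWithin (mem_nhdsWithin_of_mem_nhds (hp.isOpen.mem_nhds hx.2))

lemma tanPart_eq (hp : IsTangentProjection M O p) (hx : x ∈ M ∩ O) (v : Euc N) :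
    tanPart M x v = p x v := by rw [tanPart, hp.eq_starProjection x hx]

lemma norPart_eq (hp : IsTangentProjection M O p) (hx : x ∈ M ∩ O) (v : Euc N) :
    norPart M x v = v - p x v := by
  rw [norPart, hp.eq_starProjection x hx, Submodule.starProjection_orthogonal_val]

lemma apply_mem (hp : IsTangentProjection M O p) (hx : x ∈ M ∩ O) (v : Euc N) :
    p x v ∈ tangentSpaceAt M x := by
  rw [hp.eq_starProjection x hx]; exact Submodule.starProjection_apply_mem _ _

lemma apply_of_mem (hp : IsTangentProjection M O p) (hx : x ∈ M ∩ O)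
    (ha : a ∈ tangentSpaceAt M x) : p x a = a := by
  rw [hp.eq_starProjection x hx]; exact Submodule.starProjection_eq_self_iff.2 ha

lemma idem (hp : IsTangentProjection M O p) (hx : x ∈ M ∩ O) (v : Euc N) :
    p x (p x v) = p x v := hp.apply_of_mem hx (hp.apply_mem hx v)

lemma symm (hp : IsTangentProjection M O p) (hx : x ∈ M ∩ O) (v w : Euc N) :
    (inner ℝ (p x v) w : ℝ) = inner ℝ v (p x w) := by
  rw [hp.eq_starProjection x hx]; exact Submodule.inner_starProjection_left_eq_right _ _ _

lemma differentiableAt (hp : IsTangentProjection M O p) : DifferentiableAt ℝ p x :=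
  hp.contDiff.differentiable (by simp) x

/-- Differentiating `p ∘ p = p` along `M`. -/
lemma fderiv_idem (hp : IsTangentProjection M O p) (hx : x ∈ M ∩ O)
    (ha : a ∈ tangentSpaceAt M x) (v : Euc N) :
    fderiv ℝ p x a (p x v) + p x (fderiv ℝ p x a v) = fderiv ℝ p x a v := by
  have h1 : HasFDerivAt (fun y => p y v) ((ContinuousLinearMap.apply ℝ (Euc N) v).comp
      (fderiv ℝ p x)) x := (ContinuousLinearMap.apply ℝ (Euc N) v).hasFDerivAt.comp x
        hp.differentiableAt.hasFDerivAt
  have h2 := hp.differentiableAt.hasFDerivAt.clm_apply h1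
  have h3 := fderiv_apply_eq_of_mem_tangentSpaceAt (G := fun y => p y (p y v))
    (H := fun y => p y v) hx.1
    (Filter.mem_of_superset (hp.mem_nhdsWithin hx) fun y hy => hp.idem hy v)
    h2.differentiableAt h1.differentiableAt ha
  rw [h1.fderiv, h2.fderiv] at h3
  simpa [add_comm] using h3

/-- When `b` is tangent, `p x b = b`, and the differentiated idempotence relation leaves only the
tangential part. Hence `Dp(a) b` is normal, and it is the second fundamental form. -/
lemma apply_fderiv_of_mem (hp : IsTangentProjection M O p) (hx : x ∈ M ∩ O)
    (ha : a ∈ tangentSpaceAt M x) (hb : b ∈ tangentSpaceAt M x) :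
    p x (fderiv ℝ p x a b) = 0 := by
  have := hp.fderiv_idem hx ha b
  rwa [hp.apply_of_mem hx hb, add_eq_left] at this

lemma secondFF_eq (hp : IsTangentProjection M O p) (hx : x ∈ M ∩ O)
    (ha : a ∈ tangentSpaceAt M x) (hb : b ∈ tangentSpaceAt M x) :
    secondFF M x a b = fderiv ℝ p x a b := by
  have h1 : HasFDerivAt (fun y => p y b) ((ContinuousLinearMap.apply ℝ (Euc N) b).comp
      (fderiv ℝ p x)) x := (ContinuousLinearMap.apply ℝ (Euc N) b).hasFDerivAt.comp x
        hp.differentiableAt.hasFDerivAt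
  rw [secondFF, fderivWithin_apply_of_mem_tangentSpaceAt (H := fun y => p y b) hx.1
    (Filter.mem_of_superset (hp.mem_nhdsWithin hx) fun y hy => hp.tanPart_eq hy b)
    h1.differentiableAt ha, h1.fderiv, hp.norPart_eq hx]
  simp [hp.apply_fderiv_of_mem hx ha hb]

lemma norConn_eq (hp : IsTangentProjection M O p) {ζ : Euc N → Euc N} (hη : ContDiff ℝ ∞ η)
    (hζ : Set.EqOn ζ η (M ∩ O)) (hx : x ∈ M ∩ O) (ha : a ∈ tangentSpaceAt M x) :
    norConn M ζ x a = normalDeriv p η x a := by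
  rw [norConn, fderivWithin_apply_of_mem_tangentSpaceAt hx.1
    (Filter.mem_of_superset (hp.mem_nhdsWithin hx) hζ)
    (hη.differentiable (by simp) x) ha, hp.norPart_eq hx]
  simp [normalDeriv, hp.apply_of_mem hx ha]

/-- The extension `y ↦ b^T` is parallel at `x`, so the correction term of the covariant Hessian
drops out. -/
lemma tanConn_eq_zero (hp : IsTangentProjection M O p) (hx : x ∈ M ∩ O)
    (ha : a ∈ tangentSpaceAt M x) (hb : b ∈ tangentSpaceAt M x) :
    tanConn M (fun y => tanPart M y b) x a = 0 := by
  have h1 : HasFDerivAt (fun y => p y b) ((ContinuousLinearMap.apply ℝ (Euc N) b).comp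
      (fderiv ℝ p x)) x := (ContinuousLinearMap.apply ℝ (Euc N) b).hasFDerivAt.comp x
        hp.differentiableAt.hasFDerivAt
  rw [tanConn, fderivWithin_apply_of_mem_tangentSpaceAt (H := fun y => p y b) hx.1
    (Filter.mem_of_superset (hp.mem_nhdsWithin hx) fun y hy => hp.tanPart_eq hy b)
    h1.differentiableAt ha, h1.fderiv, hp.tanPart_eq hx]
  simp [hp.apply_fderiv_of_mem hx ha hb]

lemma norHess_eq (hp : IsTangentProjection M O p) {ζ : Euc N → Euc N} (hη : ContDiff ℝ ∞ η)
    (hζ : Set.EqOn ζ η (M ∩ O)) (hx : x ∈ M ∩ O)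
    (ha : a ∈ tangentSpaceAt M x) (hb : b ∈ tangentSpaceAt M x) :
    norHess M ζ x a b = fderiv ℝ (normalDeriv p η) x a b
      - p x (fderiv ℝ (normalDeriv p η) x a b) := by
  have h1 : HasFDerivAt (fun y => normalDeriv p η y b)
      ((ContinuousLinearMap.apply ℝ (Euc N) b).comp (fderiv ℝ (normalDeriv p η) x)) x :=
    (ContinuousLinearMap.apply ℝ (Euc N) b).hasFDerivAt.comp x
      (((contDiff_normalDeriv hp.contDiff hη).differentiable (by simp) x).hasFDerivAt)
  have h2 : norConn M ζ x 0 = 0 := by simp [norConn, norPart]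
  rw [norHess, hp.tanConn_eq_zero hx ha hb, h2, sub_zero, norConn,
    fderivWithin_apply_of_mem_tangentSpaceAt (H := fun y => normalDeriv p η y b) hx.1
    (Filter.mem_of_superset (hp.mem_nhdsWithin hx) fun y hy => ?_)
    h1.differentiableAt ha, h1.fderiv, hp.norPart_eq hx]
  · simp
  · have := hp.norConn_eq hη hζ hy (hp.apply_mem hy b)
    simp only [Set.mem_ofPred_eq, hp.tanPart_eq hy, this]
    simp [normalDeriv, hp.idem hy]

lemma frame_mem (i) : frame M x i ∈ tangentSpaceAt M x := Submodule.coe_mem _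

/-- The quadratic form of the second variation on a normal field extended by `η`. -/
lemma inner_secondVariation (hp : IsTangentProjection M O p) {ζ : Euc N → Euc N}
    (hη : ContDiff ℝ ∞ η) (hζ : Set.EqOn ζ η (M ∩ O)) (hx : x ∈ M ∩ O) (hηx : p x (η x) = 0) :
    inner ℝ (ζ x) (secondVariation M ζ x) = stabilityDensity p η x := by
  have hn (v : Euc N) : (inner ℝ (η x) (p x v) : ℝ) = 0 := by rw [← hp.symm hx, hηx]; simp
  have hS := hp.eq_starProjection x hx
  have h1 : inner ℝ (η x) (norLaplacian M ζ x) = ∑ k, inner ℝ (η x)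
      (fderiv ℝ (normalDeriv p η) x (p x (stdBasis N k)) (p x (stdBasis N k))) := by
    let B : Euc N →ₗ[ℝ] Euc N →ₗ[ℝ] ℝ := LinearMap.mk₂ ℝ
      (fun a b => inner ℝ (η x) (fderiv ℝ (normalDeriv p η) x a b))
      (by simp [inner_add_right]) (by simp [inner_smul_right]) (by simp [inner_add_right])
      (by simp [inner_smul_right])
    have := sum_bilin_orthonormalBasis _ (stdOrthonormalBasis ℝ (tangentSpaceAt M x)) B
    rw [norLaplacian, inner_sum, hS]
    refine Eq.trans (Finset.sum_congr rfl fun i _ => ?_) this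
    rw [hp.norHess_eq hη hζ hx (frame_mem i) (frame_mem i), inner_sub_right, hn, sub_zero]
    rfl
  have h2 : inner ℝ (η x) (norConn M ζ x (tanPart M x x))
      = inner ℝ (η x) (fderiv ℝ η x (p x x)) := by
    rw [hp.tanPart_eq hx, hp.norConn_eq hη hζ hx (hp.apply_mem hx x)]
    simp [normalDeriv, hp.idem hx, inner_sub_right, hn]
  have h3 : ∑ i, ∑ j, inner ℝ (secondFF M x (frame M x i) (frame M x j)) (η x) ^ 2
      = ∑ k, ∑ l, inner ℝ (fderiv ℝ p x (p x (stdBasis N k)) (p x (stdBasis N l)))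
        (η x) ^ 2 := by
    -- The trace lemma handles one slot at a time: `B` for the second argument of `A`, `C` for the
    -- first.
    let B (c : Euc N) : Euc N →ₗ[ℝ] Euc N →ₗ[ℝ] ℝ := LinearMap.mk₂ ℝ
      (fun a b => inner ℝ (fderiv ℝ p x c a) (η x) * inner ℝ (fderiv ℝ p x c b) (η x))
      (by intros; simp [inner_add_left, add_mul]) (by intros; simp [inner_smul_left, mul_assoc])
      (by intros; simp [inner_add_left, mul_add])
      (by intros; simp [inner_smul_left, mul_left_comm])
    let C (c : Euc N) : Euc N →ₗ[ℝ] Euc N →ₗ[ℝ] ℝ := LinearMap.mk₂ ℝ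
      (fun a b => inner ℝ (fderiv ℝ p x a c) (η x) * inner ℝ (fderiv ℝ p x b c) (η x))
      (by intros; simp [inner_add_left, add_mul]) (by intros; simp [inner_smul_left, mul_assoc])
      (by intros; simp [inner_add_left, mul_add])
      (by intros; simp [inner_smul_left, mul_left_comm])
    have hB c := sum_bilin_orthonormalBasis _ (stdOrthonormalBasis ℝ (tangentSpaceAt M x)) (B c)
    have hC c := sum_bilin_orthonormalBasis _ (stdOrthonormalBasis ℝ (tangentSpaceAt M x)) (C c)
    simp only [B, C, LinearMap.mk₂_apply, ← hS, ← pow_two] at hB hC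
    calc _ = ∑ i, ∑ j, inner ℝ (fderiv ℝ p x (frame M x i) (frame M x j)) (η x) ^ 2 :=
          Finset.sum_congr rfl fun i _ => Finset.sum_congr rfl fun j _ => by
            rw [hp.secondFF_eq hx (frame_mem i) (frame_mem j)]
      _ = ∑ i, ∑ l, inner ℝ (fderiv ℝ p x (frame M x i) (p x (stdBasis N l))) (η x) ^ 2 :=
          Finset.sum_congr rfl fun i _ => hB _
      _ = _ := (Finset.sum_comm.trans (Finset.sum_congr rfl fun l _ => hC _)).trans
          Finset.sum_comm
  rw [hζ hx, secondVariation, driftLaplacian, stabilityDensity, inner_add_right, inner_add_right,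
    inner_sub_right, h1, inner_smul_right, h2, ← h3, inner_smul_right, hζ hx,
    real_inner_self_eq_norm_sq, inner_sum]
  congr 2
  refine Finset.sum_congr rfl fun i _ => ?_
  rw [inner_sum]
  refine Finset.sum_congr rfl fun j _ => ?_
  rw [inner_smul_right, real_inner_comm, pow_two]

end IsTangentProjection

end

/-! ### Testing stability with multiples of the normal parts of the coordinate fields -/

/-- `u` times the normal part of the `i`-th coordinate vector field. -/
def normalCoordField (p : Euc N → Euc N →L[ℝ] Euc N) (u : Euc N → ℝ) (i : Fin N) (y : Euc N) :
    Euc N := u y • (stdBasis N i - p y (stdBasis N i))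

/-- The field `u p ∇u`. -/
def halfGradSq (p : Euc N → Euc N →L[ℝ] Euc N) (u : Euc N → ℝ) (y : Euc N) : Euc N :=
  u y • p y (gradient u y)

section

variable {M O : Set (Euc N)} {p : Euc N → Euc N →L[ℝ] Euc N} {u : Euc N → ℝ} {x a b : Euc N}

lemma contDiff_normalCoordField (hp : ContDiff ℝ ∞ p) (hu : ContDiff ℝ ∞ u) (i : Fin N) :
    ContDiff ℝ ∞ (normalCoordField p u i) :=
  hu.smul (contDiff_const.sub (hp.clm_apply contDiff_const))

lemma contDiff_gradient (hu : ContDiff ℝ ∞ u) : ContDiff ℝ ∞ (gradient u) :=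
  (InnerProductSpace.toDual ℝ (Euc N)).symm.contDiff.comp (hu.fderiv_right (m := ∞) (by simp))

lemma contDiff_halfGradSq (hp : ContDiff ℝ ∞ p) (hu : ContDiff ℝ ∞ u) :
    ContDiff ℝ ∞ (halfGradSq p u) :=
  hu.smul (hp.clm_apply (contDiff_gradient hu))

lemma inner_gradient_eq (v : Euc N) : (inner ℝ (gradient u x) v : ℝ) = fderiv ℝ u x v :=
  InnerProductSpace.toDual_symm_apply

lemma fderiv_normalCoordField (hp : ContDiff ℝ ∞ p) (hu : ContDiff ℝ ∞ u) (i : Fin N) :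
    fderiv ℝ (normalCoordField p u i) x a =
      fderiv ℝ u x a • (stdBasis N i - p x (stdBasis N i))
        - u x • fderiv ℝ p x a (stdBasis N i) := by
  have h1 : HasFDerivAt (fun y => p y (stdBasis N i))
      ((ContinuousLinearMap.apply ℝ (Euc N) (stdBasis N i)).comp (fderiv ℝ p x)) x :=
    (ContinuousLinearMap.apply ℝ (Euc N) (stdBasis N i)).hasFDerivAt.comp x
      (hp.differentiable (by simp) x).hasFDerivAt
  have h2 := (hu.differentiable (by simp) x).hasFDerivAt.smul (h1.const_sub (stdBasis N i))
  change fderiv ℝ (u • fun y => stdBasis N i - p y (stdBasis N i)) x a = _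
  rw [h2.fderiv]
  simp
  abel

namespace IsTangentProjection

variable (hp : IsTangentProjection M O p)
  (hd : ∀ y ∈ M ∩ O, Module.finrank ℝ (tangentSpaceAt M y) = n)
include hp

lemma apply_normalCoordField (hx : x ∈ M ∩ O) (i : Fin N) : p x (normalCoordField p u i x) = 0 := by
  simp [normalCoordField, hp.idem hx]

include hd

lemma sum_norm_sq_normalCoordField (hx : x ∈ M ∩ O) :
    ∑ i, ‖normalCoordField p u i x‖ ^ 2 = (N - n) * u x ^ 2 := by
  simp only [normalCoordField, norm_smul, mul_pow, hp.eq_starProjection x hx]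
  rw [← Finset.mul_sum, sum_norm_sq_sub_starProjection, hd x hx, Real.norm_eq_abs, sq_abs, mul_comm]

/-- Half the derivative of the previous identity. That identity holds only on `M ∩ O`, which is why
`a` must be tangent. -/
lemma sum_inner_fderiv_normalCoordField (hu : ContDiff ℝ ∞ u) (hx : x ∈ M ∩ O)
    (ha : a ∈ tangentSpaceAt M x) :
    ∑ i, inner ℝ (normalCoordField p u i x) (fderiv ℝ (normalCoordField p u i) x a)
      = (N - n) * (u x * fderiv ℝ u x a) := by
  have h1 (i) := ((contDiff_normalCoordField hp.contDiff hu i).differentiable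
    (by simp) x).hasFDerivAt.norm_sq
  have h2 := HasFDerivAt.fun_sum (u := Finset.univ) fun i _ => h1 i
  have h3 := ((hu.differentiable (by simp) x).hasFDerivAt.pow 2).const_mul ((N : ℝ) - n)
  have h4 := fderiv_apply_eq_of_mem_tangentSpaceAt hx.1 (Filter.mem_of_superset
    (hp.mem_nhdsWithin hx) fun y hy => hp.sum_norm_sq_normalCoordField hd hy)
    h2.differentiableAt h3.differentiableAt ha
  rw [h2.fderiv, h3.fderiv] at h4
  simp [← Finset.mul_sum] at h4
  linarith

lemma sum_inner_fderiv_normal (hx : x ∈ M ∩ O) (ha : a ∈ tangentSpaceAt M x) :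
    ∑ i, inner ℝ (stdBasis N i - p x (stdBasis N i)) (fderiv ℝ p x a (stdBasis N i)) = 0 := by
  have := hp.sum_inner_fderiv_normalCoordField hd (u := fun _ => 1) contDiff_const hx ha
  simp only [fderiv_normalCoordField hp.contDiff contDiff_const] at this
  simpa [normalCoordField] using this

lemma sum_inner_normalDeriv (hu : ContDiff ℝ ∞ u) (hx : x ∈ M ∩ O) (b : Euc N) :
    ∑ i, inner ℝ (normalCoordField p u i x) (normalDeriv p (normalCoordField p u i) x b)
      = (N - n) * inner ℝ (halfGradSq p u x) b := by
  have h (i) : (inner ℝ (normalCoordField p u i x)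
      (normalDeriv p (normalCoordField p u i) x b) : ℝ) = inner ℝ (normalCoordField p u i x)
        (fderiv ℝ (normalCoordField p u i) x (p x b)) := by
    simp [normalDeriv, inner_sub_right, ← hp.symm hx, hp.apply_normalCoordField hx]
  rw [Finset.sum_congr rfl fun i _ => h i,
    hp.sum_inner_fderiv_normalCoordField hd hu hx (hp.apply_mem hx b)]
  simp [halfGradSq, inner_smul_left, hp.symm hx]

/-- The Leibniz rule for `sum_inner_normalDeriv`. -/
lemma sum_inner_fderiv_normalDeriv (hu : ContDiff ℝ ∞ u) (hx : x ∈ M ∩ O)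
    (ha : a ∈ tangentSpaceAt M x) (b : Euc N) :
    ∑ i, inner ℝ (normalCoordField p u i x)
        (fderiv ℝ (normalDeriv p (normalCoordField p u i)) x a b)
      = (N - n) * inner ℝ (fderiv ℝ (halfGradSq p u) x a) b
        - ∑ i, inner ℝ (fderiv ℝ (normalCoordField p u i) x a)
            (normalDeriv p (normalCoordField p u i) x b) := by
  have h1 (i) := ((contDiff_normalCoordField hp.contDiff hu i).differentiable
    (by simp) x).hasFDerivAt
  have h2 (i) : HasFDerivAt (fun y => normalDeriv p (normalCoordField p u i) y b)
      ((ContinuousLinearMap.apply ℝ (Euc N) b).comp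
        (fderiv ℝ (normalDeriv p (normalCoordField p u i)) x)) x :=
    (ContinuousLinearMap.apply ℝ (Euc N) b).hasFDerivAt.comp x
      (((contDiff_normalDeriv hp.contDiff
        (contDiff_normalCoordField hp.contDiff hu i)).differentiable (by simp) x).hasFDerivAt)
  have h3 := HasFDerivAt.fun_sum (u := Finset.univ) fun i _ => (h1 i).inner ℝ (h2 i)
  have h4 := ((((contDiff_halfGradSq hp.contDiff hu).differentiable
    (by simp) x).hasFDerivAt.inner ℝ (hasFDerivAt_const b x))).const_mul ((N : ℝ) - n)
  have h5 := fderiv_apply_eq_of_mem_tangentSpaceAt hx.1 (Filter.mem_of_superset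
    (hp.mem_nhdsWithin hx) fun y hy => hp.sum_inner_normalDeriv hd hu hy b)
    h3.differentiableAt h4.differentiableAt ha
  rw [h3.fderiv, h4.fderiv] at h5
  simp [Finset.sum_add_distrib] at h5
  linarith

/-- With `v = eᵢ - p eᵢ` and `z = Dp(a)(p eᵢ)`, the normal part of `D_a ηᵢ` is `(∂_a u) v - u z`.
The squares give the two terms on the right; the mixed terms vanish after summation by
`sum_inner_fderiv_normal`, the case `u = 1`. -/
lemma sum_norm_sq_normalDeriv (hu : ContDiff ℝ ∞ u) (hx : x ∈ M ∩ O)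
    (ha : a ∈ tangentSpaceAt M x) :
    ∑ i, inner ℝ (fderiv ℝ (normalCoordField p u i) x a)
            (normalDeriv p (normalCoordField p u i) x a)
      = (N - n) * fderiv ℝ u x a ^ 2
        + u x ^ 2 * ∑ i, ‖fderiv ℝ p x a (p x (stdBasis N i))‖ ^ 2 := by
  have hN (i) : p x (fderiv ℝ p x a (p x (stdBasis N i))) = 0 :=
    hp.apply_fderiv_of_mem hx ha (hp.apply_mem hx _)
  have h (i) : (inner ℝ (fderiv ℝ (normalCoordField p u i) x a)
            (normalDeriv p (normalCoordField p u i) x a) : ℝ)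
      = fderiv ℝ u x a ^ 2 * ‖stdBasis N i - p x (stdBasis N i)‖ ^ 2
        - 2 * u x * fderiv ℝ u x a *
          inner ℝ (stdBasis N i - p x (stdBasis N i)) (fderiv ℝ p x a (stdBasis N i))
        + u x ^ 2 * ‖fderiv ℝ p x a (p x (stdBasis N i))‖ ^ 2 := by
    set v := stdBasis N i - p x (stdBasis N i) with hv
    set w := fderiv ℝ p x a (stdBasis N i) with hw
    have hw' : w = fderiv ℝ p x a (p x (stdBasis N i)) + p x w := (hp.fderiv_idem hx ha _).symm
    set z := fderiv ℝ p x a (p x (stdBasis N i)) with hz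
    have hpv : p x v = 0 := by simp [hv, hp.idem hx]
    have e1 : (inner ℝ v w : ℝ) = inner ℝ v z := by
      rw [hw', inner_add_right, ← hp.symm hx, hpv]; simp
    have e2 : (inner ℝ w z : ℝ) = inner ℝ z z := by
      nth_rw 1 [hw']
      rw [inner_add_left, hp.symm hx, hN i]; simp
    have e3 : normalDeriv p (normalCoordField p u i) x a = fderiv ℝ u x a • v - u x • z := by
      have : w - p x w = z := by rw [sub_eq_iff_eq_add]; exact hw'
      simp only [normalDeriv, ContinuousLinearMap.comp_apply, sub_apply,
        ContinuousLinearMap.id_apply, hp.apply_of_mem hx ha,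
        fderiv_normalCoordField hp.contDiff hu]
      rw [← hv, ← hw, map_sub, map_smul, map_smul, hpv, ← this, smul_zero, smul_sub (u x)]
      abel
    rw [e3, fderiv_normalCoordField hp.contDiff hu, ← hv, ← hw, e1]
    simp only [inner_sub_left, inner_sub_right, inner_smul_left, inner_smul_right, e2,
      real_inner_self_eq_norm_sq, real_inner_comm v w, e1]
    simp
    ring
  rw [Finset.sum_congr rfl fun i _ => h i, Finset.sum_add_distrib, Finset.sum_sub_distrib,
    ← Finset.mul_sum, ← Finset.mul_sum, ← Finset.mul_sum, hp.sum_inner_fderiv_normal hd hx ha,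
    hp.eq_starProjection x hx, sum_norm_sq_sub_starProjection, hd x hx]
  ring

/-- The Leibniz rule turns the Laplacian term into the divergence of `u p ∇u` minus the energy of
the fields `ηᵢ`. The part `u² |A|²` of that energy cancels against the curvature term `h3`. -/
lemma sum_stabilityDensity (hu : ContDiff ℝ ∞ u) (hx : x ∈ M ∩ O) :
    ∑ i, stabilityDensity p (normalCoordField p u i) x =
      (N - n) * ((divAlong (tangentSpaceAt M x) (halfGradSq p u) x
        - (1 / 2) * inner ℝ x (halfGradSq p u x))
        - ‖p x (gradient u x)‖ ^ 2 + (1 / 2) * u x ^ 2) := by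
  have hT (k) := hp.apply_mem hx (stdBasis N k)
  have h1 : ∑ i, ∑ k, inner ℝ (normalCoordField p u i x)
      (fderiv ℝ (normalDeriv p (normalCoordField p u i)) x (p x (stdBasis N k))
        (p x (stdBasis N k))) =
      (N - n) * (divAlong (tangentSpaceAt M x) (halfGradSq p u) x - ‖p x (gradient u x)‖ ^ 2)
        - u x ^ 2 * ∑ k, ∑ l, ‖fderiv ℝ p x (p x (stdBasis N k)) (p x (stdBasis N l))‖ ^ 2 := by
    have e : ‖p x (gradient u x)‖ ^ 2 = ∑ k, fderiv ℝ u x (p x (stdBasis N k)) ^ 2 := by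
      rw [← (stdBasis N).sum_sq_norm_inner_right]
      refine Finset.sum_congr rfl fun k _ => ?_
      rw [← hp.symm hx, real_inner_comm, inner_gradient_eq, Real.norm_eq_abs, sq_abs]
    rw [Finset.sum_comm, divAlong, trace_starProjection_comp, e, ← hp.eq_starProjection x hx,
      mul_sub, Finset.mul_sum, Finset.mul_sum, Finset.mul_sum, ← Finset.sum_sub_distrib,
      ← Finset.sum_sub_distrib]
    refine Finset.sum_congr rfl fun k _ => ?_
    rw [hp.sum_inner_fderiv_normalDeriv hd hu hx (hT k),
      hp.sum_norm_sq_normalDeriv hd hu hx (hT k), real_inner_comm]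
    ring
  have h2 : ∑ i, inner ℝ (normalCoordField p u i x) (fderiv ℝ (normalCoordField p u i) x (p x x))
      = (N - n) * inner ℝ x (halfGradSq p u x) := by
    rw [hp.sum_inner_fderiv_normalCoordField hd hu hx (hp.apply_mem hx x), ← inner_gradient_eq,
      ← real_inner_comm x, halfGradSq, inner_smul_left, hp.symm hx]
    simp
  have h3 : ∑ i, ∑ k, ∑ l, inner ℝ (fderiv ℝ p x (p x (stdBasis N k)) (p x (stdBasis N l)))
      (normalCoordField p u i x) ^ 2
      = u x ^ 2 * ∑ k, ∑ l, ‖fderiv ℝ p x (p x (stdBasis N k)) (p x (stdBasis N l))‖ ^ 2 := by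
    rw [Finset.sum_comm, Finset.mul_sum]
    refine Finset.sum_congr rfl fun k _ => ?_
    rw [Finset.sum_comm, Finset.mul_sum]
    refine Finset.sum_congr rfl fun l _ => ?_
    rw [← (stdBasis N).sum_sq_norm_inner_left, Finset.mul_sum]
    refine Finset.sum_congr rfl fun i _ => ?_
    rw [normalCoordField, inner_smul_right, inner_sub_right, ← hp.symm hx,
      hp.apply_fderiv_of_mem hx (hT k) (hT l), Real.norm_eq_abs, sq_abs, mul_pow]
    simp
  simp only [stabilityDensity, Finset.sum_add_distrib, Finset.sum_sub_distrib, ← Finset.mul_sum]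
  rw [h1, h2, h3, hp.sum_norm_sq_normalCoordField hd hx]
  ring

end IsTangentProjection

end

/-! ### Smoothness of orthogonal projections -/

section RangeProj

variable {F E : Type*} [NormedAddCommGroup F] [InnerProductSpace ℝ F] [FiniteDimensional ℝ F]
  [NormedAddCommGroup E] [InnerProductSpace ℝ E] [FiniteDimensional ℝ E]

lemma isUnit_adjoint_comp_self {B : F →L[ℝ] E} (hB : Function.Injective B) :
    IsUnit ((B.adjoint ∘L B : F →L[ℝ] F)) := by
  have hinj : Function.Injective (B.adjoint ∘L B) := by
    rw [injective_iff_map_eq_zero]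
    intro v hv
    have : (inner ℝ (B v) (B v) : ℝ) = 0 := by
      rw [← ContinuousLinearMap.adjoint_inner_right]
      change inner ℝ v ((B.adjoint ∘L B) v) = (0 : ℝ)
      rw [hv, inner_zero_right]
    exact hB (by simpa using this)
  rw [ContinuousLinearMap.isUnit_iff_bijective]
  exact ⟨hinj, (LinearMap.injective_iff_surjective
    (f := (B.adjoint ∘L B : F →L[ℝ] F).toLinearMap)).1 hinj⟩

/-- This normal-equation formula for the projection onto the range shows its smooth dependence on
`B`, since inversion is smooth at units. -/
lemma comp_inverse_comp_adjoint_eq_starProjection {B : F →L[ℝ] E} (hB : Function.Injective B)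
    {T : Submodule ℝ E} (hT : LinearMap.range B.toLinearMap = T) :
    B ∘L (Ring.inverse (B.adjoint ∘L B : F →L[ℝ] F)) ∘L B.adjoint = T.starProjection := by
  ext v
  refine (Submodule.eq_starProjection_of_mem_of_inner_eq_zero ?_ fun w hw => ?_).symm
  · rw [← hT]; exact ⟨_, rfl⟩
  · rw [← hT] at hw
    obtain ⟨z, rfl⟩ := hw
    have h := Ring.mul_inverse_cancel _ (isUnit_adjoint_comp_self hB)
    have h2 := congrArg (fun A : F →L[ℝ] F => A (B.adjoint v)) h
    change B.adjoint (B (Ring.inverse (B.adjoint ∘L B) (B.adjoint v))) = B.adjoint v at h2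
    change (inner ℝ (v - B (Ring.inverse (B.adjoint ∘L B) (B.adjoint v))) (B z) : ℝ) = 0
    rw [← ContinuousLinearMap.adjoint_inner_left, map_sub, h2, sub_self, inner_zero_left]

lemma ContDiffAt.adjoint {G : Type*} [NormedAddCommGroup G] [NormedSpace ℝ G]
    {B : G → F →L[ℝ] E} {x : G} (hB : ContDiffAt ℝ ∞ B x) :
    ContDiffAt ℝ ∞ (fun y => (B y).adjoint) x := by
  let A : (F →L[ℝ] E) →L[ℝ] (E →L[ℝ] F) := LinearMap.mkContinuous
    { toFun := fun B => B.adjoint, map_add' := fun B C => map_add ContinuousLinearMap.adjoint B C,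
      map_smul' := fun c B => by simp } 1 (fun B => by simp)
  exact A.contDiff.contDiffAt.comp x hB

lemma ContDiffAt.comp_inverse_comp_adjoint {G : Type*} [NormedAddCommGroup G] [NormedSpace ℝ G]
    {B : G → F →L[ℝ] E} {x : G} (hB : ContDiffAt ℝ ∞ B x) (hinj : Function.Injective (B x)) :
    ContDiffAt ℝ ∞ (fun y => B y ∘L (Ring.inverse ((B y).adjoint ∘L B y : F →L[ℝ] F)) ∘L
      (B y).adjoint) x := by
  have hA := ContDiffAt.adjoint hB
  obtain ⟨a, ha⟩ := isUnit_adjoint_comp_self hinj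
  have h1 : ContDiffAt ℝ ∞ Ring.inverse ((B x).adjoint ∘L B x : F →L[ℝ] F) := by
    rw [← ha]; exact contDiffAt_ringInverse ℝ a
  have h2 : ContDiffAt ℝ ∞ (fun y => ((B y).adjoint ∘L B y : F →L[ℝ] F)) x := hA.clm_comp hB
  have h3 : ContDiffAt ℝ ∞
      (fun y => Ring.inverse ((B y).adjoint ∘L B y : F →L[ℝ] F)) x :=
    ContDiffAt.comp (g := Ring.inverse) (f := fun y => ((B y).adjoint ∘L B y : F →L[ℝ] F)) x h1 h2
  exact hB.clm_comp (h3.clm_comp hA)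

end RangeProj

/-! ### Charts of submanifolds -/

/-- `φ` is a smooth chart of `ℝ^N` flattening the set `S` to the `n`-plane `P`. -/
structure IsFlatteningChart (n : ℕ) (S : Set (Euc N))
    (φ : OpenPartialHomeomorph (Euc N) (Euc N)) (P : Submodule ℝ (Euc N)) : Prop where
  contDiffOn : ContDiffOn ℝ ∞ φ φ.source
  contDiffOn_symm : ContDiffOn ℝ ∞ φ.symm φ.target
  finrank_eq : Module.finrank ℝ P = n
  mem_iff : ∀ y ∈ φ.source, (y ∈ S ↔ φ y ∈ P)

namespace IsFlatteningChart

variable {S : Set (Euc N)} {φ : OpenPartialHomeomorph (Euc N) (Euc N)}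
  {P : Submodule ℝ (Euc N)} {x y z : Euc N}

lemma contDiffAt (h : IsFlatteningChart n S φ P) (hy : y ∈ φ.source) : ContDiffAt ℝ ∞ φ y :=
  h.contDiffOn.contDiffAt (φ.open_source.mem_nhds hy)

lemma contDiffAt_symm (h : IsFlatteningChart n S φ P) (hz : z ∈ φ.target) :
    ContDiffAt ℝ ∞ φ.symm z :=
  h.contDiffOn_symm.contDiffAt (φ.open_target.mem_nhds hz)

lemma hasFDerivAt (h : IsFlatteningChart n S φ P) (hy : y ∈ φ.source) :
    HasFDerivAt φ (fderiv ℝ φ y) y :=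
  ((h.contDiffAt hy).differentiableAt (by simp)).hasFDerivAt

lemma hasFDerivAt_symm (h : IsFlatteningChart n S φ P) (hy : y ∈ φ.source) :
    HasFDerivAt φ.symm (fderiv ℝ φ.symm (φ y)) (φ y) :=
  ((h.contDiffAt_symm (φ.map_source hy)).differentiableAt (by simp)).hasFDerivAt

lemma fderiv_symm_apply_fderiv (h : IsFlatteningChart n S φ P) (hy : y ∈ φ.source) (v : Euc N) :
    fderiv ℝ φ.symm (φ y) (fderiv ℝ φ y v) = v := by
  have h1 := (h.hasFDerivAt_symm hy).comp y (h.hasFDerivAt hy)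
  have h2 : HasFDerivAt (φ.symm ∘ φ) (ContinuousLinearMap.id ℝ (Euc N)) y :=
    (hasFDerivAt_id y).congr_of_eventuallyEq (Filter.mem_of_superset
      (φ.open_source.mem_nhds hy) fun z hz => φ.left_inv hz)
  exact congrArg (fun A : Euc N →L[ℝ] Euc N => A v) (h1.unique h2)

lemma fderiv_apply_fderiv_symm (h : IsFlatteningChart n S φ P) (hy : y ∈ φ.source) (v : Euc N) :
    fderiv ℝ φ y (fderiv ℝ φ.symm (φ y) v) = v := by
  have h0 := h.hasFDerivAt hy
  have h1 := HasFDerivAt.comp (φ y) (g := φ) (g' := fderiv ℝ φ y)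
    (by rw [φ.left_inv hy]; exact h0) (h.hasFDerivAt_symm hy)
  have h2 : HasFDerivAt (φ ∘ φ.symm) (ContinuousLinearMap.id ℝ (Euc N)) (φ y) :=
    (hasFDerivAt_id (φ y)).congr_of_eventuallyEq (Filter.mem_of_superset
      (φ.open_target.mem_nhds (φ.map_source hy)) fun z hz => φ.right_inv hz)
  exact congrArg (fun A : Euc N →L[ℝ] Euc N => A v) (h1.unique h2)

lemma mem_of_mem_target (h : IsFlatteningChart n S φ P) (hz : z ∈ φ.target) (hzP : z ∈ P) :
    φ.symm z ∈ S :=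
  (h.mem_iff _ (φ.map_target hz)).2 (by rwa [φ.right_inv hz])

/-- The tangent cone of a linear subspace at one of its points is the subspace, and derivatives map
tangent cones to tangent cones. Applying this to `φ` and to `φ.symm` gives the two inclusions. -/
lemma tangentSpaceAt_eq (h : IsFlatteningChart n S φ P) (hy : y ∈ φ.source) (hyS : y ∈ S) :
    tangentSpaceAt S y = P.map (fderiv ℝ φ.symm (φ y)).toLinearMap := by
  have hP : tangentConeAt ℝ (P : Set (Euc N)) (φ y) = P := by
    ext v
    have hyP := (h.mem_iff y hy).1 hyS
    constructor
    · intro hv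
      obtain ⟨α, l, hl, c, d, -, hd, hcd⟩ := exists_fun_of_mem_tangentConeAt hv
      refine P.closed_of_finiteDimensional.mem_of_tendsto hcd (hd.mono fun k hk => ?_)
      exact P.smul_mem _ (by simpa using P.sub_mem hk hyP)
    · intro hv
      have := mem_tangentConeAt_of_segment_subset (s := (P : Set (Euc N)))
        (P.convex.segment_subset hyP (P.add_mem hyP hv))
      rwa [add_sub_cancel_left] at this
  apply le_antisymm
  · refine Submodule.span_le.2 fun v hv => ?_
    refine ⟨fderiv ℝ φ y v, ?_, h.fderiv_symm_apply_fderiv hy v⟩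
    rw [← tangentConeAt_inter_nhds (φ.open_source.mem_nhds hy)] at hv
    have := (h.hasFDerivAt hy).hasFDerivWithinAt.mapsTo_tangent_cone hv
    rw [← hP]
    refine tangentConeAt_mono ?_ this
    rintro _ ⟨z, hz, rfl⟩
    exact (h.mem_iff z hz.2).1 hz.1
  · rintro _ ⟨v, hv, rfl⟩
    refine Submodule.subset_span ?_
    rw [SetLike.mem_coe, ← SetLike.mem_coe, ← hP,
      ← tangentConeAt_inter_nhds (φ.open_target.mem_nhds (φ.map_source hy))] at hv
    have := (h.hasFDerivAt_symm hy).hasFDerivWithinAt.mapsTo_tangent_cone hv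
    rw [φ.left_inv hy] at this
    refine tangentConeAt_mono ?_ this
    rintro _ ⟨z, hz, rfl⟩
    exact h.mem_of_mem_target hz.2 hz.1

lemma fderiv_symm_injective (h : IsFlatteningChart n S φ P) (hy : y ∈ φ.source) :
    Function.Injective (fderiv ℝ φ.symm (φ y)) :=
  Function.LeftInverse.injective (h.fderiv_apply_fderiv_symm hy)

lemma finrank_tangentSpaceAt (h : IsFlatteningChart n S φ P) (hy : y ∈ φ.source) (hyS : y ∈ S) :
    Module.finrank ℝ (tangentSpaceAt S y) = n := by
  rw [h.tangentSpaceAt_eq hy hyS, ← h.finrank_eq]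
  exact (Submodule.equivMapOfInjective _ (h.fderiv_symm_injective hy) P).finrank_eq.symm

/-- The tangential projection has a smooth extension to the domain of a chart. -/
lemma exists_contDiffOn_starProjection (h : IsFlatteningChart n S φ P) :
    ∃ p : Euc N → Euc N →L[ℝ] Euc N, ContDiffOn ℝ ∞ p φ.source ∧
      ∀ y ∈ φ.source, y ∈ S → p y = (tangentSpaceAt S y).starProjection := by
  let B : Euc N → P →L[ℝ] Euc N := fun y => fderiv ℝ φ.symm (φ y) ∘L P.subtypeL
  have hinj (y) (hy : y ∈ φ.source) : Function.Injective (B y) :=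
    (h.fderiv_symm_injective hy).comp Subtype.val_injective
  refine ⟨fun y => B y ∘L (Ring.inverse ((B y).adjoint ∘L B y : P →L[ℝ] P)) ∘L
    (B y).adjoint, fun y hy => ?_, fun y hy hyS => ?_⟩
  · refine (ContDiffAt.comp_inverse_comp_adjoint ?_ (hinj y hy)).contDiffWithinAt
    have h1 : ContDiffAt ℝ ∞ (fderiv ℝ φ.symm) (φ y) :=
      (h.contDiffAt_symm (φ.map_source hy)).fderiv_right (m := ∞) (by simp)
    exact (h1.comp y (h.contDiffAt hy)).clm_comp contDiffAt_const
  · refine comp_inverse_comp_adjoint_eq_starProjection (hinj y hy) ?_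
    rw [h.tangentSpaceAt_eq hy hyS]
    simp [B, LinearMap.range_comp]

end IsFlatteningChart

/-! ### Support and regular set of a varifold -/

namespace RectifiableVarifold

variable (V : RectifiableVarifold N n U)

/-- The union of the domains, within `U`, of the charts of `ℝ^N` that flatten the support. -/
def chartDomain : Set (Euc N) :=
  {x | x ∈ U ∧ ∃ φ P, x ∈ φ.source ∧ IsFlatteningChart n V.spt φ P}

variable {V}

lemma spt_eq : V.spt = U ∩ V.weight.support := by
  ext x; simp [spt, Measure.mem_support_iff_forall]

lemma ae_mem_spt : ∀ᵐ x ∂V.weight, x ∈ V.spt := by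
  rw [spt_eq]
  exact Filter.inter_mem (mem_ae_iff.2 V.weight_compl) V.weight.support_mem_ae

lemma isClosed_inter_spt {K : Set (Euc N)} (hK : IsClosed K) (hKU : K ⊆ U) :
    IsClosed (K ∩ V.spt) := by
  rw [spt_eq, ← Set.inter_assoc, Set.inter_eq_left.2 hKU]
  exact hK.inter V.weight.isClosed_support

lemma chartDomain_subset : V.chartDomain ⊆ U := fun _ hx => hx.1

lemma isOpen_chartDomain (hU : IsOpen U) : IsOpen V.chartDomain := by
  rw [isOpen_iff_mem_nhds]
  rintro x ⟨hxU, φ, P, hx, h⟩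
  filter_upwards [hU.mem_nhds hxU, φ.open_source.mem_nhds hx] with y hy hy'
  exact ⟨hy, φ, P, hy', h⟩

lemma mem_reg_iff {x : Euc N} : x ∈ V.reg ↔ x ∈ V.spt ∧ x ∈ V.chartDomain := by
  constructor
  · rintro ⟨hx, φ, P, h1, h2, h3, h4, h5⟩
    exact ⟨hx, hx.1, φ, P, h1, h2, h3, h4, h5⟩
  · rintro ⟨hx, -, φ, P, h1, h2, h3, h4, h5⟩
    exact ⟨hx, φ, P, h1, h2, h3, h4, h5⟩

lemma reg_subset_chartDomain : V.reg ⊆ V.chartDomain := fun _ hx => (mem_reg_iff.1 hx).2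

lemma reg_subset_spt : V.reg ⊆ V.spt := fun _ hx => (mem_reg_iff.1 hx).1

/-- The regular set need not be closed, but inside the chart domain it coincides with the support,
which is relatively closed in `U`. This provides the compactness used below. -/
lemma inter_reg_eq {K : Set (Euc N)} (hK : K ⊆ V.chartDomain) : K ∩ V.reg = K ∩ V.spt := by
  ext x
  exact ⟨fun h => ⟨h.1, reg_subset_spt h.2⟩, fun h => ⟨h.1, mem_reg_iff.2 ⟨h.2, hK h.1⟩⟩⟩

lemma isCompact_inter_reg {K : Set (Euc N)} (hK : IsCompact K) (hKV : K ⊆ V.chartDomain) :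
    IsCompact (K ∩ V.reg) := by
  rw [inter_reg_eq hKV]
  exact hK.of_isClosed_subset
    (isClosed_inter_spt hK.isClosed (hKV.trans chartDomain_subset)) Set.inter_subset_left

lemma ae_mem_reg_of_mem_chartDomain : ∀ᵐ x ∂V.weight, x ∈ V.chartDomain → x ∈ V.reg := by
  filter_upwards [V.ae_mem_spt] with x hx hx'
  exact mem_reg_iff.2 ⟨hx, hx'⟩

/-- A chart flattening the support flattens the regular set. -/
lemma _root_.GaussianVarifold.IsFlatteningChart.reg
    {φ : OpenPartialHomeomorph (Euc N) (Euc N)} {P : Submodule ℝ (Euc N)}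
    (h : IsFlatteningChart n V.spt φ P) : IsFlatteningChart n V.reg φ P where
  contDiffOn := h.contDiffOn
  contDiffOn_symm := h.contDiffOn_symm
  finrank_eq := h.finrank_eq
  mem_iff y hy := by
    rw [← h.mem_iff y hy]
    exact ⟨fun h' => reg_subset_spt h', fun h' => mem_reg_iff.2 ⟨h', h'.1, φ, P, hy, h⟩⟩

lemma finrank_tangentSpaceAt_reg {x : Euc N} (hx : x ∈ V.reg) :
    Module.finrank ℝ (tangentSpaceAt V.reg x) = n := by
  obtain ⟨-, φ, P, h1, h⟩ := reg_subset_chartDomain hx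
  exact h.reg.finrank_tangentSpaceAt h1 hx

/-- The local extensions from charts are glued by a partition of unity. The prescribed values form a
singleton on `K' ∩ V.reg` and the whole space elsewhere, so they are convex; closedness of `K' ∩
V.reg` permits the local choice `0` off it. -/
lemma exists_isTangentProjection (hU : IsOpen U) {K : Set (Euc N)} (hK : IsCompact K)
    (hKV : K ⊆ V.chartDomain) :
    ∃ O p, K ⊆ O ∧ O ⊆ V.chartDomain ∧ IsTangentProjection V.reg O p := by
  obtain ⟨K', hK', hKK', hK'V⟩ := exists_compact_between hK (isOpen_chartDomain hU) hKV
  have hcl : IsClosed (K' ∩ V.reg) := (isCompact_inter_reg hK' hK'V).isClosed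
  let t : Euc N → Set (Euc N →L[ℝ] Euc N) := fun y =>
    {A | y ∈ K' ∩ V.reg → A = (tangentSpaceAt V.reg y).starProjection}
  have ht (y : Euc N) : Convex ℝ (t y) := by
    by_cases hy : y ∈ K' ∩ V.reg
    · have : t y = {(tangentSpaceAt V.reg y).starProjection} := by
        ext A; exact ⟨fun h => h hy, fun h _ => h⟩
      rw [this]; exact convex_singleton _
    · have : t y = Set.univ := by
        ext A; exact ⟨fun _ => trivial, fun _ h => (hy h).elim⟩
      rw [this]; exact convex_univ
  obtain ⟨g, hg⟩ := exists_contMDiffMap_forall_mem_convex_of_local (n := ⊤)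
    (modelWithCornersSelf ℝ (Euc N)) ht (fun x => by
      by_cases hx : x ∈ K' ∩ V.reg
      · obtain ⟨-, φ, P, h1, h⟩ := hK'V hx.1
        obtain ⟨p, hp, hp'⟩ := h.reg.exists_contDiffOn_starProjection
        exact ⟨φ.source, φ.open_source.mem_nhds h1, p, hp.contMDiffOn,
          fun y hy hy' => hp' y hy hy'.2⟩
      · exact ⟨(K' ∩ V.reg)ᶜ, hcl.isOpen_compl.mem_nhds hx, fun _ => 0, contMDiffOn_const,
          fun y hy hy' => (hy hy').elim⟩)
  exact ⟨interior K', g, hKK', interior_subset.trans hK'V, g.contMDiff.contDiff, isOpen_interior,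
    fun y hy => hg y ⟨interior_subset hy.2, hy.1⟩⟩

/-! ### The approximate tangent plane on the regular set -/

lemma exists_weight_lt_top (hU : IsOpen U) {x : Euc N} (hx : x ∈ U) :
    ∃ ε > 0, Metric.closedBall x ε ⊆ U ∧ V.weight (Metric.closedBall x ε) < ⊤ := by
  obtain ⟨ε, hε, h⟩ := Metric.nhds_basis_closedBall.mem_iff.1 (hU.mem_nhds hx)
  exact ⟨ε, hε, h, V.weight_lt_top _ (isCompact_closedBall x ε) h⟩

/-- Vectors of an approximate tangent plane are tangent to the support. -/
lemma mem_of_hasApproxTangentPlane {x : Euc N} {θ : ℝ}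
    {P : Submodule ℝ (Euc N)} (h : HasApproxTangentPlane n V.weight x θ P) {v : Euc N}
    (hv : v ∈ P) {T : Submodule ℝ (Euc N)} (hT : tangentConeAt ℝ V.spt x ⊆ T) : v ∈ T := by
  by_contra hvT
  obtain ⟨ε, hε, hεT⟩ := Metric.nhds_basis_closedBall.mem_iff.1
    (T.closed_of_finiteDimensional.isOpen_compl.mem_nhds hvT)
  obtain ⟨hθ, i, hi, hlim⟩ := h
  let f : ContDiffBump v := ⟨ε / 2, ε, by positivity, by linarith⟩
  have hf := hlim f f.continuous f.hasCompactSupport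
  -- Otherwise, by compactness, points `z` of the ball with `x + r z` in the support would
  -- accumulate, as `r` tends to `0`, at a tangent vector in the ball, which is disjoint from `T`.
  have hzero : ∀ᶠ r : ℝ in 𝓝[>] 0, ∀ z ∈ Metric.closedBall v ε, x + r • z ∉ V.spt := by
    by_contra hcon
    obtain ⟨r, hr, hrz⟩ := exists_seq_forall_of_frequently (not_eventually.1 hcon)
    push Not at hrz
    choose z hz hzS using hrz
    obtain ⟨z₀, hz₀, k, hk, hzk⟩ := (isCompact_closedBall v ε).tendsto_subseq hz
    have hr0 : Tendsto (fun m => r (k m)) atTop (𝓝 0) :=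
      (tendsto_nhds_of_tendsto_nhdsWithin hr).comp hk.tendsto_atTop
    have hrpos : ∀ᶠ m in atTop, 0 < r (k m) :=
      hk.tendsto_atTop.eventually (tendsto_nhdsWithin_iff.1 hr).2
    refine hεT hz₀ (hT ?_)
    refine mem_tangentConeAt_of_seq atTop (fun m => (r (k m))⁻¹) (fun m => r (k m) • z (k m))
      ?_ (Filter.Eventually.of_forall fun m => hzS _) ?_
    · simpa using hr0.smul hzk
    · refine hzk.congr' ?_
      filter_upwards [hrpos] with m hm
      simp [smul_smul, inv_mul_cancel₀ hm.ne']
  have hf0 : Tendsto (fun r : ℝ => (r ^ n)⁻¹ * ∫ y, f (r⁻¹ • (y - x)) ∂V.weight) (𝓝[>] 0)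
      (𝓝 0) := by
    refine tendsto_const_nhds.congr' ?_
    filter_upwards [hzero, self_mem_nhdsWithin] with r hr hr0
    rw [integral_eq_zero_of_ae, mul_zero]
    filter_upwards [V.ae_mem_spt] with y hy
    by_contra hne
    have hsupp : r⁻¹ • (y - x) ∈ Function.support f := hne
    rw [f.support_eq] at hsupp
    refine hr _ (Metric.ball_subset_closedBall hsupp) ?_
    rwa [smul_smul, mul_inv_cancel₀ (ne_of_gt hr0), one_smul, add_sub_cancel]
  have hint := tendsto_nhds_unique hf hf0
  rw [← hi] at hv
  obtain ⟨z, hz⟩ := hv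
  have hpos : 0 < ∫ z : Euc n, f (i z) := by
    refine Continuous.integral_pos_of_hasCompactSupport_nonneg_nonzero (x := z)
      (f.continuous.comp i.continuous) ?_ (fun _ => f.nonneg) ?_
    · exact f.hasCompactSupport.comp_isClosedEmbedding i.isometry.isClosedEmbedding
    · have : f (i z) = 1 := by
        rw [show i z = v from hz]
        exact f.one_of_mem_closedBall (Metric.mem_closedBall_self f.rIn_pos.le)
      rw [this]; exact one_ne_zero
  exact (mul_pos hθ hpos).ne' hint

/-- One inclusion holds by the preceding lemma, and both spaces have dimension `n`. -/
lemma approxTangentPlane_eq {x : Euc N} (hx : x ∈ V.reg)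
    (h : ∃ (P : Submodule ℝ (Euc N)) (θ : ℝ), HasApproxTangentPlane n V.weight x θ P) :
    V.approxTangentPlane x = tangentSpaceAt V.reg x := by
  rw [approxTangentPlane, dif_pos h]
  obtain ⟨θ, hθ⟩ := h.choose_spec
  have hle : h.choose ≤ tangentSpaceAt V.reg x := fun v hv => by
    refine mem_of_hasApproxTangentPlane hθ hv ?_
    obtain ⟨-, φ, P, h1, h2⟩ := reg_subset_chartDomain hx
    refine subset_trans (Eq.subset ?_) (Submodule.subset_span)
    rw [← tangentConeAt_inter_nhds (φ.open_source.mem_nhds h1),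
      ← tangentConeAt_inter_nhds (s := V.reg) (φ.open_source.mem_nhds h1)]
    congr 1
    ext y
    refine and_congr_left fun hy => ?_
    rw [h2.mem_iff y hy, h2.reg.mem_iff y hy]
  refine Submodule.eq_of_le_of_finrank_eq hle ?_
  obtain ⟨-, i, hi, -⟩ := hθ
  rw [finrank_tangentSpaceAt_reg hx, ← hi, LinearMap.finrank_range_of_inj i.injective]
  simp

lemma ae_approxTangentPlane_eq :
    ∀ᵐ x ∂V.weight, x ∈ V.reg → V.approxTangentPlane x = tangentSpaceAt V.reg x := by
  filter_upwards [V.ae_tangent] with x hx hxr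
  exact approxTangentPlane_eq hxr hx

end RectifiableVarifold

/-! ### The inequality for smooth functions -/

lemma continuous_stabilityDensity {p : Euc N → Euc N →L[ℝ] Euc N} {η : Euc N → Euc N}
    (hp : ContDiff ℝ ∞ p) (hη : ContDiff ℝ ∞ η) : Continuous (stabilityDensity p η) := by
  have h1 : Continuous (fderiv ℝ (normalDeriv p η)) :=
    (contDiff_normalDeriv hp hη).continuous_fderiv (by simp)
  have h2 : Continuous (fderiv ℝ η) := hη.continuous_fderiv (by simp)
  have h3 : Continuous (fderiv ℝ p) := hp.continuous_fderiv (by simp)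
  have h4 := hp.continuous
  have h5 := hη.continuous
  unfold stabilityDensity
  fun_prop

namespace RectifiableVarifold

variable {V : RectifiableVarifold N n U}

lemma integrable_of_continuous {f : Euc N → ℝ} (hf : Continuous f) {K : Set (Euc N)}
    (hK : IsCompact K) (hKU : K ⊆ U) (hfK : ∀ x ∉ K, f x = 0) : Integrable f V.weight := by
  have hcs : HasCompactSupport f := HasCompactSupport.intro hK hfK
  obtain ⟨C, hC⟩ := hcs.exists_bound_of_continuous hf
  rw [← integrableOn_iff_integrable_of_support_subset (s := K)
    (fun x hx => by_contra fun hxK => hx (hfK x hxK))]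
  exact Measure.integrableOn_of_bounded (V.weight_lt_top K hK hKU).ne
    hf.aestronglyMeasurable (Eventually.of_forall hC)

lemma continuous_gaussian : Continuous fun x : Euc N => Real.exp (-‖x‖ ^ 2 / 4) := by fun_prop

/-- Almost every point is off the support of `u` or regular. -/
lemma ae_notMem_tsupport_or {O : Set (Euc N)} (hO : O ⊆ V.chartDomain) {u : Euc N → ℝ}
    (huO : tsupport u ⊆ O) : ∀ᵐ x ∂V.weight, x ∉ tsupport u ∨ x ∈ V.reg ∩ O := by
  filter_upwards [V.ae_mem_reg_of_mem_chartDomain] with x hx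
  by_cases hxu : x ∈ tsupport u
  · exact Or.inr ⟨hx (hO (huO hxu)), huO hxu⟩
  · exact Or.inl hxu

variable {O : Set (Euc N)} {p : Euc N → Euc N →L[ℝ] Euc N}
  (hp : IsTangentProjection V.reg O p) (hO : O ⊆ V.chartDomain) {u : Euc N → ℝ}
  (hu : ContDiff ℝ ∞ u) (huc : HasCompactSupport u) (huO : tsupport u ⊆ O)
include hp hO hu huc huO

lemma integral_stabilityDensity_nonpos (i : Fin N) (hstab : V.IsGaussianStable) :
    ∫ x, stabilityDensity p (normalCoordField p u i) x * Real.exp (-‖x‖ ^ 2 / 4) ∂V.weight ≤ 0 := by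
  set η := normalCoordField p u i with hη
  have hηs : ContDiff ℝ ∞ η := contDiff_normalCoordField hp.contDiff hu i
  have hη0 (x) (hx : x ∉ tsupport u) : η x = 0 := by
    simp [hη, normalCoordField, image_eq_zero_of_notMem_tsupport hx]
  -- Stability demands a topological support inside the regular set, whereas the ambient field `η`
  -- is supported in a neighbourhood; cutting off to the regular set changes nothing on it.
  let ζ : Euc N → Euc N := V.reg.indicator η
  have hζ : Set.EqOn ζ η V.reg := fun x hx => Set.indicator_of_mem hx η
  have hcomp := isCompact_inter_reg huc (huO.trans hO)
  have hsupp : tsupport ζ ⊆ tsupport u ∩ V.reg := by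
    refine closure_minimal (fun x hx => ?_) hcomp.isClosed
    have hxr : x ∈ V.reg := by_contra fun h => hx (Set.indicator_of_notMem h η)
    refine ⟨by_contra fun h => hx ?_, hxr⟩
    rw [hζ hxr, hη0 x h]
  have h := hstab ζ (hηs.contDiffOn.congr hζ) (fun x hx => ?_)
    (hcomp.of_isClosed_subset (isClosed_tsupport _) hsupp) (hsupp.trans Set.inter_subset_right)
  · refine (integral_congr_ae ?_).trans_le h
    filter_upwards [ae_notMem_tsupport_or hO huO] with x hx
    rcases hx with hx | hx
    · have : ζ x = 0 := by
        by_cases hr : x ∈ V.reg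
        · rw [hζ hr, hη0 x hx]
        · exact Set.indicator_of_notMem hr _
      simp [this, stabilityDensity, hη0 x hx]
    · rw [hp.inner_secondVariation hηs (hζ.mono Set.inter_subset_left) hx
        (hp.apply_normalCoordField hx i)]
  · rw [hζ hx]
    by_cases hxu : x ∈ tsupport u
    · rw [hη, normalCoordField, hp.eq_starProjection x ⟨hx, huO hxu⟩]
      exact Submodule.smul_mem _ _ (Submodule.sub_starProjection_mem_orthogonal _)
    · rw [hη0 x hxu]; exact Submodule.zero_mem _

/-- The inequality for smooth functions supported in the domain of the extended tangential
projection. -/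
theorem integral_sq_le_of_contDiff (hn : n < N) (hstat : V.IsFStationary)
    (hstab : V.IsGaussianStable) :
    ∫ x, u x ^ 2 * Real.exp (-‖x‖ ^ 2 / 4) ∂V.weight ≤
      2 * ∫ x, ‖p x (gradient u x)‖ ^ 2 * Real.exp (-‖x‖ ^ 2 / 4) ∂V.weight := by
  have hKU : tsupport u ⊆ U := huO.trans (hO.trans chartDomain_subset)
  have hu0 (x) (hx : x ∉ tsupport u) : u x = 0 := image_eq_zero_of_notMem_tsupport hx
  have hgrad0 (x) (hx : x ∉ tsupport u) : gradient u x = 0 := by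
    have : fderiv ℝ u x = 0 := image_eq_zero_of_notMem_tsupport
      fun h => hx (tsupport_fderiv_subset ℝ h)
    simp [gradient, this]
  have hI1 : Integrable (fun x => u x ^ 2 * Real.exp (-‖x‖ ^ 2 / 4)) V.weight :=
    integrable_of_continuous ((hu.continuous.pow 2).mul continuous_gaussian) huc hKU
      fun x hx => by simp [hu0 x hx]
  have hI2 : Integrable (fun x => ‖p x (gradient u x)‖ ^ 2 * Real.exp (-‖x‖ ^ 2 / 4)) V.weight :=
    integrable_of_continuous (((hp.contDiff.continuous.clm_apply
      (contDiff_gradient hu).continuous).norm.pow 2).mul continuous_gaussian) huc hKU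
      fun x hx => by simp [hgrad0 x hx]
  have hI3 (i : Fin N) : Integrable (fun x => stabilityDensity p (normalCoordField p u i) x *
      Real.exp (-‖x‖ ^ 2 / 4)) V.weight :=
    integrable_of_continuous ((continuous_stabilityDensity hp.contDiff
      (contDiff_normalCoordField hp.contDiff hu i)).mul continuous_gaussian) huc hKU
      fun x hx => by simp [stabilityDensity, normalCoordField, hu0 x hx]
  have hX : ContDiff ℝ ∞ (halfGradSq p u) := contDiff_halfGradSq hp.contDiff hu
  have hX0 : tsupport (halfGradSq p u) ⊆ tsupport u :=
    closure_mono fun x hx => fun h => hx (by simp [halfGradSq, h])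
  -- The field `u p ∇u` is the one whose first variation appears in the summed stability density.
  have hs := hstat (halfGradSq p u) (hX.of_le (by simp))
    (huc.of_isClosed_subset (isClosed_tsupport _) hX0) (hX0.trans hKU)
  have hae : (fun x => (divAlong (V.approxTangentPlane x) (halfGradSq p u) x
      - (1 / 2) * inner ℝ x (halfGradSq p u x)) * Real.exp (-‖x‖ ^ 2 / 4)) =ᵐ[V.weight]
      fun x => ((N : ℝ) - n)⁻¹ * ∑ i, (stabilityDensity p (normalCoordField p u i) x *
        Real.exp (-‖x‖ ^ 2 / 4)) + ‖p x (gradient u x)‖ ^ 2 * Real.exp (-‖x‖ ^ 2 / 4)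
        - (1 / 2) * (u x ^ 2 * Real.exp (-‖x‖ ^ 2 / 4)) := by
    -- Positive codimension matters here: otherwise there would be no normal fields to test with.
    have hc : (N : ℝ) - n ≠ 0 := sub_ne_zero.2 (by exact_mod_cast hn.ne')
    filter_upwards [ae_notMem_tsupport_or hO huO, V.ae_approxTangentPlane_eq]
      with x hx hxT
    rcases hx with hx | hx
    · have hX' : fderiv ℝ (halfGradSq p u) x = 0 := image_eq_zero_of_notMem_tsupport
        fun h => hx (hX0 (tsupport_fderiv_subset ℝ h))
      simp [hu0 x hx, hgrad0 x hx, divAlong, hX', stabilityDensity, normalCoordField, halfGradSq]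
    · rw [hxT hx.1, ← Finset.sum_mul, hp.sum_stabilityDensity
        (fun y hy => finrank_tangentSpaceAt_reg hy.1) hu hx]
      field_simp
      ring
  have hA : Integrable (fun x => ((N : ℝ) - n)⁻¹ * ∑ i,
      (stabilityDensity p (normalCoordField p u i) x * Real.exp (-‖x‖ ^ 2 / 4))) V.weight :=
    (integrable_finsetSum _ fun i _ => hI3 i).const_mul _
  have hAB := hA.fun_add hI2
  rw [integral_congr_ae hae, integral_sub hAB (hI1.const_mul _), integral_add hA hI2,
    integral_const_mul, integral_const_mul, integral_finsetSum _ fun i _ => hI3 i] at hs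
  have hle : ∑ i, ∫ x, stabilityDensity p (normalCoordField p u i) x *
      Real.exp (-‖x‖ ^ 2 / 4) ∂V.weight ≤ 0 :=
    Finset.sum_nonpos fun i _ => integral_stabilityDensity_nonpos hp hO hu huc huO i hstab
  have hc : 0 ≤ ((N : ℝ) - n)⁻¹ := inv_nonneg.2 (sub_nonneg.2 (by exact_mod_cast hn.le))
  nlinarith [mul_nonneg hc (neg_nonneg.2 hle)]

end RectifiableVarifold

/-! ### Mollification of Lipschitz functions -/

section Mollify

variable {E : Type*} [NormedAddCommGroup E] [InnerProductSpace ℝ E] [FiniteDimensional ℝ E]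
  [MeasurableSpace E] [BorelSpace E]

/-- The standard bump function supported in the unit ball. -/
def unitBump (E : Type*) [NormedAddCommGroup E] : ContDiffBump (0 : E) :=
  ⟨1 / 2, 1, by norm_num, by norm_num⟩

/-- The mollification of `w` at scale `ε`. -/
def mollify (w : E → ℝ) (ε : ℝ) (x : E) : ℝ :=
  ∫ t, (unitBump E).normed volume t * w (x - ε • t)

variable {w : E → ℝ} {ε : ℝ} {C : NNReal}

lemma mollify_eq_convolution (hε : ε ≠ 0) (x : E) :
    mollify w ε x = convolution ((unitBump E).normed volume) (fun y => w (ε • y))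
      (ContinuousLinearMap.lsmul ℝ ℝ) volume (ε⁻¹ • x) := by
  simp [mollify, convolution, smul_sub, smul_smul, hε]

lemma contDiff_mollify (hw : Continuous w) (hε : ε ≠ 0) : ContDiff ℝ ∞ (mollify w ε) := by
  have h1 : LocallyIntegrable (fun y => w (ε • y)) :=
    (hw.comp (continuous_const_smul ε)).locallyIntegrable
  have h2 := (unitBump E).hasCompactSupport_normed.contDiff_convolution_left (n := ⊤)
    (ContinuousLinearMap.lsmul ℝ ℝ) ((unitBump E).contDiff_normed (μ := volume)) h1
  rw [funext (mollify_eq_convolution (w := w) hε)]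
  exact h2.comp (contDiff_const_smul ε⁻¹)

/-- The derivative falls on the bump, so continuity of `w` is enough. -/
lemma hasFDerivAt_mollify (hw : Continuous w) (hε : ε ≠ 0) (x : E) :
    HasFDerivAt (mollify w ε)
      (ε⁻¹ • ∫ t, w (x - ε • t) • fderiv ℝ ((unitBump E).normed volume) t) x := by
  have h1 : LocallyIntegrable (fun y => w (ε • y)) :=
    (hw.comp (continuous_const_smul ε)).locallyIntegrable
  have h2 := (unitBump E).hasCompactSupport_normed.hasFDerivAt_convolution_left
    (ContinuousLinearMap.lsmul ℝ ℝ) ((unitBump E).contDiff_normed (n := 1) (μ := volume)) h1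
    (ε⁻¹ • x)
  rw [funext (mollify_eq_convolution (w := w) hε)]
  refine (h2.comp x ((hasFDerivAt_id x).const_smul ε⁻¹)).congr_fderiv ?_
  have key : convolution (fderiv ℝ ((unitBump E).normed volume)) (fun y => w (ε • y))
      (ContinuousLinearMap.precompL E (ContinuousLinearMap.lsmul ℝ ℝ)) volume (ε⁻¹ • x)
      = ∫ t, w (x - ε • t) • fderiv ℝ ((unitBump E).normed volume) t := by
    refine integral_congr_ae (Eventually.of_forall fun t => ?_)
    ext v
    simp [smul_sub, smul_smul, hε, mul_comm]
  rw [key]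
  ext v
  simp

lemma integrable_normed_mul {g : E → ℝ} (hg : Continuous g) :
    Integrable fun t => (unitBump E).normed volume t * g t :=
  ((unitBump E).continuous_normed.mul hg).integrable_of_hasCompactSupport
    (unitBump E).hasCompactSupport_normed.mul_right

lemma integrable_smul_fderiv_normed {g : E → ℝ} (hg : Continuous g) :
    Integrable fun t => g t • fderiv ℝ ((unitBump E).normed volume) t :=
  (hg.smul (((unitBump E).contDiff_normed (n := 1)).continuous_fderiv
    (by simp))).integrable_of_hasCompactSupport
    ((unitBump E).hasCompactSupport_normed.fderiv ℝ).smul_left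

lemma normed_eq_zero {t : E} (ht : 1 ≤ ‖t‖) : (unitBump E).normed volume t = 0 := by
  rw [← Function.notMem_support, ContDiffBump.support_normed_eq]
  simpa [unitBump] using ht

lemma lipschitzWith_mollify (hw : LipschitzWith C w) : LipschitzWith C (mollify w ε) := by
  refine LipschitzWith.of_dist_le_mul fun x y => ?_
  have hi (x : E) : Integrable fun t => (unitBump E).normed volume t * w (x - ε • t) :=
    integrable_normed_mul (hw.continuous.comp (by fun_prop))
  rw [Real.dist_eq, mollify, mollify, ← integral_sub (hi x) (hi y), ← Real.norm_eq_abs]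
  have : C * dist x y = ∫ t, (unitBump E).normed volume t * (C * dist x y) := by
    rw [integral_mul_const, (unitBump E).integral_normed, one_mul]
  rw [this]
  refine norm_integral_le_of_norm_le (integrable_normed_mul continuous_const)
    (Eventually.of_forall fun t => ?_)
  rw [← mul_sub, norm_mul, Real.norm_of_nonneg ((unitBump E).nonneg_normed t)]
  refine mul_le_mul_of_nonneg_left ?_ ((unitBump E).nonneg_normed t)
  simpa [Real.dist_eq] using hw.dist_le_mul (x - ε • t) (y - ε • t)

lemma abs_mollify_sub_le (hw : LipschitzWith C w) (hε : 0 ≤ ε) (x : E) :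
    |mollify w ε x - w x| ≤ C * ε := by
  have hi : Integrable fun t => (unitBump E).normed volume t * w (x - ε • t) :=
    integrable_normed_mul (hw.continuous.comp (by fun_prop))
  have h1 (c : ℝ) : c = ∫ t, (unitBump E).normed volume t * c := by
    rw [integral_mul_const, (unitBump E).integral_normed, one_mul]
  rw [mollify, h1 (w x), h1 (C * ε), ← integral_sub hi (integrable_normed_mul continuous_const),
    ← Real.norm_eq_abs]
  refine norm_integral_le_of_norm_le (integrable_normed_mul continuous_const)
    (Eventually.of_forall fun t => ?_)
  rw [← mul_sub, norm_mul, Real.norm_of_nonneg ((unitBump E).nonneg_normed t)]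
  rcases le_or_gt 1 ‖t‖ with ht | ht
  · simp [normed_eq_zero ht]
  · refine mul_le_mul_of_nonneg_left ?_ ((unitBump E).nonneg_normed t)
    have := hw.dist_le_mul (x - ε • t) x
    rw [dist_eq_norm, dist_eq_norm, sub_sub_cancel_left, norm_neg, norm_smul,
      Real.norm_of_nonneg hε] at this
    exact this.trans (mul_le_mul_of_nonneg_left (mul_le_of_le_one_right hε ht.le) C.2)

lemma tsupport_mollify_subset (hε : 0 ≤ ε) :
    tsupport (mollify w ε) ⊆ Metric.cthickening ε (tsupport w) := by
  refine closure_minimal (fun x hx => ?_) Metric.isClosed_cthickening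
  by_contra hcon
  refine hx ((integral_congr_ae (Eventually.of_forall fun t => ?_)).trans (integral_zero E ℝ))
  rcases le_or_gt 1 ‖t‖ with ht | ht
  · simp [normed_eq_zero ht]
  · have : x - ε • t ∉ tsupport w := fun h => hcon <| Metric.mem_cthickening_of_dist_le _ _ _ _ h
      (by simpa [dist_eq_norm, norm_smul, abs_of_nonneg hε] using
        mul_le_of_le_one_right hε ht.le)
    simp [image_eq_zero_of_notMem_tsupport this]

lemma integral_fderiv_normed : ∫ t, fderiv ℝ ((unitBump E).normed volume) t = 0 := by
  have h := hasFDerivAt_mollify (w := fun _ : E => (1 : ℝ)) continuous_const one_ne_zero 0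
  have h2 : mollify (fun _ : E => (1 : ℝ)) 1 = fun _ => ∫ t, (unitBump E).normed volume t := by
    ext x; simp [mollify]
  rw [h2] at h
  simpa using h.unique (hasFDerivAt_const _ _)

/-- Mollifying a linear form changes it by a constant only; comparing derivatives gives the identity
without an integration by parts. -/
lemma integral_apply_smul_fderiv_normed (L : E →L[ℝ] ℝ) :
    ∫ t, L (-t) • fderiv ℝ ((unitBump E).normed volume) t = L := by
  have h := hasFDerivAt_mollify (w := L) L.continuous one_ne_zero 0
  have h2 : mollify L 1 = fun x => L x - ∫ t, (unitBump E).normed volume t * L t := by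
    ext x
    simp only [mollify, one_smul, map_sub, mul_sub]
    rw [integral_sub (integrable_normed_mul continuous_const) (integrable_normed_mul L.continuous),
      integral_mul_const, (unitBump E).integral_normed, one_mul]
  rw [h2] at h
  simpa using h.unique (L.hasFDerivAt.sub_const _)

/-- As the derivative of the bump has integral zero, `w x` may be subtracted under the integral. The
difference quotients then converge to `Dw(x)(-t)` and are dominated by `C ‖t‖`. -/
lemma tendsto_fderiv_mollify (hw : LipschitzWith C w) {x : E} (hx : DifferentiableAt ℝ w x) :
    Tendsto (fun ε => fderiv ℝ (mollify w ε) x) (𝓝[>] 0) (𝓝 (fderiv ℝ w x)) := by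
  have hi : Integrable (fun t : E => (C * ‖t‖) • fderiv ℝ ((unitBump E).normed volume) t) :=
    integrable_smul_fderiv_normed (g := fun t => C * ‖t‖) (by fun_prop)
  have h1 : Tendsto (fun ε => ∫ t : E, (ε⁻¹ * (w (x - ε • t) - w x)) •
      fderiv ℝ ((unitBump E).normed volume) t) (𝓝[>] 0)
      (𝓝 (∫ t : E, fderiv ℝ w x (-t) • fderiv ℝ ((unitBump E).normed volume) t)) := by
    refine tendsto_integral_filter_of_dominated_convergence _ ?_ ?_ hi.norm ?_
    · have := hw.continuous
      exact Eventually.of_forall fun ε => (integrable_smul_fderiv_normed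
        (g := fun t : E => ε⁻¹ * (w (x - ε • t) - w x)) (by fun_prop)).aestronglyMeasurable
    · filter_upwards [self_mem_nhdsWithin] with ε hε
      refine Eventually.of_forall fun t => ?_
      have hε' : (0 : ℝ) < ε := hε
      rw [norm_smul, norm_smul, norm_mul, norm_inv, Real.norm_of_nonneg hε'.le,
        Real.norm_of_nonneg (by positivity : (0 : ℝ) ≤ C * ‖t‖)]
      refine mul_le_mul_of_nonneg_right ?_ (norm_nonneg _)
      have := hw.dist_le_mul (x - ε • t) x
      rw [dist_eq_norm, dist_eq_norm, sub_sub_cancel_left, norm_neg, norm_smul,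
        Real.norm_of_nonneg hε'.le] at this
      rw [inv_mul_le_iff₀ hε']
      linarith
    · refine Eventually.of_forall fun t => Tendsto.smul_const ?_ _
      have h2 := (hx.hasFDerivAt.hasLineDerivAt (-t)).tendsto_slope_zero_right
      simpa [sub_eq_add_neg] using h2
  rw [integral_apply_smul_fderiv_normed (E := E)] at h1
  refine h1.congr' ?_
  filter_upwards [self_mem_nhdsWithin] with ε hε
  have hε' : ε ≠ 0 := ne_of_gt hε
  rw [(hasFDerivAt_mollify hw.continuous hε' x).fderiv, ← integral_smul]
  have h3 : ∫ t, (ε⁻¹ * w x) • fderiv ℝ ((unitBump E).normed volume) t = 0 := by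
    rw [integral_smul, integral_fderiv_normed, smul_zero]
  have hA : Integrable fun t => ε⁻¹ • w (x - ε • t) • fderiv ℝ ((unitBump E).normed volume) t :=
    (integrable_smul_fderiv_normed (g := fun t : E => w (x - ε • t))
      (hw.continuous.comp (by fun_prop))).smul ε⁻¹
  rw [← sub_zero (∫ t, ε⁻¹ • w (x - ε • t) • fderiv ℝ ((unitBump E).normed volume) t), ← h3,
    ← integral_sub hA (integrable_smul_fderiv_normed continuous_const)]
  refine integral_congr_ae (Eventually.of_forall fun t => ?_)
  simp only [smul_smul, ← sub_smul, mul_sub]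

end Mollify

/-! ### Absolute continuity of the weight in charts -/

/-- A measure with finite upper `n`-density pushes forward to an absolutely continuous measure under
a map to `ℝⁿ` with Lipschitz inverse. -/
lemma measure_inter_preimage_eq_zero {μ : Measure (Euc N)} {B : Set (Euc N)}
    (hB : MeasurableSet B) (hμB : μ B ≠ ⊤) {g : Euc N → Euc n} (hg : ContinuousOn g B) {K : ℝ}
    (hK : 0 < K) (hgK : ∀ x ∈ B, ∀ y ∈ B, dist x y ≤ K * dist (g x) (g y))
    (hd : ∀ᵐ x ∂μ, x ∈ B → ∃ k : ℕ, ∀ᶠ r in 𝓝[>] (0 : ℝ),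
      μ (Metric.closedBall x r) ≤ ENNReal.ofReal (k * r ^ n))
    {Z : Set (Euc n)} (hZ : volume Z = 0) : μ (B ∩ g ⁻¹' Z) = 0 := by
  have : IsFiniteMeasure (μ.restrict B) := ⟨by simpa using hμB.lt_top⟩
  have hgm : AEMeasurable g (μ.restrict B) := hg.aemeasurable hB
  set ν := (μ.restrict B).map g with hν
  -- Countably many pieces, each with a uniform density constant `k`.
  let A : ℕ → Set (Euc N) := fun k => {x | x ∈ B ∧ ∀ᶠ r in 𝓝[>] (0 : ℝ),
      μ (Metric.closedBall x r) ≤ ENNReal.ofReal (k * r ^ n)}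
  have hsub : μ ((B ∩ g ⁻¹' Z) \ ⋃ k, A k ∩ g ⁻¹' Z) = 0 := by
    refine measure_mono_null (fun x hx => ?_) (ae_iff.1 hd)
    intro h
    obtain ⟨k, hk⟩ := h hx.1.1
    exact hx.2 (Set.mem_iUnion.2 ⟨k, ⟨hx.1.1, hk⟩, hx.1.2⟩)
  refine measure_mono_null (t := ((B ∩ g ⁻¹' Z) \ ⋃ k, A k ∩ g ⁻¹' Z) ∪ ⋃ k, A k ∩ g ⁻¹' Z)
    (by simp) (measure_union_null hsub (measure_iUnion_null fun k => ?_))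
  set S := g '' (A k ∩ g ⁻¹' Z) with hS
  have hSZ : volume S = 0 := measure_mono_null (by rintro _ ⟨x, hx, rfl⟩; exact hx.2) hZ
  set b := (volume : Measure (Euc n)).real (Metric.ball 0 1) with hb
  have hbpos : 0 < b := ENNReal.toReal_pos (Metric.measure_ball_pos _ _ one_pos).ne'
    measure_ball_lt_top.ne
  have hνS : ν S = 0 := by
    -- A ball of radius `r` about `g x` pulls back within `B` into a ball of radius `K r`, of weight
    -- at most `k (K r)^n`; its Lebesgue measure is `b r^n`. The ratio is the constant, and
    -- Besicovitch covering passes from balls to `S`.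
    have h := (Besicovitch.vitaliFamily ν).measure_le_of_frequently_le
      ((k * K ^ n / b).toNNReal • (volume : Measure (Euc n))) (ρ := ν) (fun _ h => h) S ?_
    · refine le_antisymm (h.trans ?_) zero_le
      simp [hSZ]
    · rintro _ ⟨x, hx, rfl⟩
      refine (Besicovitch.tendsto_filterAt ν (g x)).frequently (Eventually.frequently ?_)
      have hlim : Tendsto (fun r : ℝ => K * r) (𝓝[>] 0) (𝓝[>] 0) := by
        refine tendsto_nhdsWithin_iff.2 ⟨?_, ?_⟩
        · have : Tendsto (fun r : ℝ => K * r) (𝓝 0) (𝓝 (K * 0)) := tendsto_id.const_mul K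
          rw [mul_zero] at this
          exact this.mono_left nhdsWithin_le_nhds
        · filter_upwards [self_mem_nhdsWithin] with r hr
          exact mul_pos hK hr
      filter_upwards [hlim.eventually hx.1.2, self_mem_nhdsWithin] with r hr hr0
      have hr0' : (0 : ℝ) < r := hr0
      rw [hν, Measure.map_apply_of_aemeasurable hgm Metric.isClosed_closedBall.measurableSet,
        Measure.restrict_apply' hB]
      calc _ ≤ μ (Metric.closedBall x (K * r)) := measure_mono fun y hy => by
            refine (hgK y hy.2 x hx.1.1).trans ?_
            exact mul_le_mul_of_nonneg_left hy.1 hK.le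
        _ ≤ _ := hr
        _ = _ := by
          rw [Measure.smul_apply, Measure.addHaar_closedBall _ _ hr0'.le, ENNReal.smul_def,
            smul_eq_mul, finrank_euclideanSpace_fin, ← ENNReal.ofReal_toReal
            (measure_ball_lt_top (μ := (volume : Measure (Euc n))) (x := 0) (r := 1)).ne,
            ← ENNReal.ofReal, ← ENNReal.ofReal_mul (by positivity),
            ← ENNReal.ofReal_mul (by positivity)]
          congr 1
          change _ = k * K ^ n / b * (r ^ n * b)
          field_simp
          ring
  have hAB : A k ∩ g ⁻¹' Z ⊆ B := fun x hx => hx.1.1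
  rw [← Measure.restrict_eq_self μ hAB]
  refine measure_mono_null (Set.subset_preimage_image g _) ?_
  exact le_antisymm ((Measure.le_map_apply hgm S).trans_eq hνS) zero_le

namespace RectifiableVarifold

variable {V : RectifiableVarifold N n U}

/-- A bump equal to `1` on the unit ball dominates its indicator, and the rescaled integrals of the
bump converge, so any `k` above the limit works. -/
lemma exists_weight_closedBall_le (hU : IsOpen U) {x : Euc N} (hx : x ∈ U)
    {P : Submodule ℝ (Euc N)} {θ : ℝ} (h : HasApproxTangentPlane n V.weight x θ P) :
    ∃ k : ℕ, ∀ᶠ r in 𝓝[>] (0 : ℝ),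
      V.weight (Metric.closedBall x r) ≤ ENNReal.ofReal (k * r ^ n) := by
  obtain ⟨-, i, -, hlim⟩ := h
  obtain ⟨ε, hε, hεU, hfin⟩ := V.exists_weight_lt_top hU hx
  let f : ContDiffBump (0 : Euc N) := ⟨1, 2, by norm_num, by norm_num⟩
  have hf := hlim f f.continuous f.hasCompactSupport
  obtain ⟨k, hk⟩ := exists_nat_gt (θ * ∫ z : Euc n, f (i z))
  refine ⟨k, ?_⟩
  have hr2 : ∀ᶠ r : ℝ in 𝓝[>] 0, 2 * r < ε := by
    have : ∀ᶠ r : ℝ in 𝓝 0, 2 * r < ε := by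
      exact ((continuous_const.mul continuous_id).tendsto' (0 : ℝ) 0
        (by simp)).eventually_lt_const hε
    exact this.filter_mono nhdsWithin_le_nhds
  filter_upwards [hf.eventually_lt_const hk, hr2, self_mem_nhdsWithin] with r hr hrε hr0
  have hr0' : (0 : ℝ) < r := hr0
  have hfi : Integrable (fun y => f (r⁻¹ • (y - x))) V.weight := by
    refine integrable_of_continuous (f.continuous.comp (by fun_prop))
      (isCompact_closedBall x ε) hεU fun y hy => ?_
    refine f.zero_of_le_dist ?_
    rw [dist_zero_right, norm_smul, norm_inv, Real.norm_of_nonneg hr0'.le, inv_mul_eq_div,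
      le_div_iff₀ hr0', ← dist_eq_norm]
    rw [Metric.mem_closedBall, not_le] at hy
    exact (hrε.trans hy).le
  have hle : V.weight (Metric.closedBall x r) ≤
      ENNReal.ofReal (∫ y, f (r⁻¹ • (y - x)) ∂V.weight) := by
    rw [ofReal_integral_eq_lintegral_ofReal hfi (Eventually.of_forall fun _ => f.nonneg),
      ← lintegral_indicator_one Metric.isClosed_closedBall.measurableSet]
    refine lintegral_mono fun y => ?_
    by_cases hy : y ∈ Metric.closedBall x r
    · rw [Set.indicator_of_mem hy, f.one_of_mem_closedBall]
      · simp
      · change r⁻¹ • (y - x) ∈ Metric.closedBall 0 1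
        rw [mem_closedBall_zero_iff, norm_smul, norm_inv, Real.norm_of_nonneg hr0'.le,
          inv_mul_le_iff₀ hr0', mul_one, ← dist_eq_norm]
        exact hy
    · rw [Set.indicator_of_notMem hy]; exact zero_le
  refine hle.trans (ENNReal.ofReal_le_ofReal ?_)
  rw [inv_mul_lt_iff₀ (by positivity)] at hr
  linarith

end RectifiableVarifold

/-! ### Coordinates of a flattening chart -/

namespace IsFlatteningChart

variable {S : Set (Euc N)} {φ : OpenPartialHomeomorph (Euc N) (Euc N)}
  {P : Submodule ℝ (Euc N)}

/-- An isometry of `ℝⁿ` onto the `n`-plane `P`. -/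
def planeIsometry (h : IsFlatteningChart n S φ P) : P ≃ₗᵢ[ℝ] Euc n :=
  ((stdOrthonormalBasis ℝ P).reindex (finCongr h.finrank_eq)).repr

/-- The coordinates of the foot point in the `n`-plane. -/
def coord (h : IsFlatteningChart n S φ P) (y : Euc N) : Euc n :=
  h.planeIsometry (P.orthogonalProjectionOnto (φ y))

/-- The parametrization of `S` inverse to `coord`. -/
def param (h : IsFlatteningChart n S φ P) (z : Euc n) : Euc N :=
  φ.symm (h.planeIsometry.symm z : P)

/-- The domain of the parametrization. -/
def paramDomain (h : IsFlatteningChart n S φ P) : Set (Euc n) :=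
  {z | ((h.planeIsometry.symm z : P) : Euc N) ∈ φ.target}

variable (h : IsFlatteningChart n S φ P)

lemma isOpen_paramDomain : IsOpen h.paramDomain :=
  φ.open_target.preimage (continuous_subtype_val.comp h.planeIsometry.symm.continuous)

lemma contDiffOn_param : ContDiffOn ℝ ∞ h.param h.paramDomain := by
  refine h.contDiffOn_symm.comp (g := φ.symm) (ContDiff.contDiffOn ?_) fun z hz => hz
  exact P.subtypeL.contDiff.comp h.planeIsometry.symm.contDiff

lemma mapsTo_param : Set.MapsTo h.param h.paramDomain S := fun _ hz =>
  h.mem_of_mem_target hz (Submodule.coe_mem _)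

lemma contDiffOn_coord : ContDiffOn ℝ ∞ h.coord φ.source :=
  (h.planeIsometry.contDiff.comp (P.orthogonalProjectionOnto).contDiff).comp_contDiffOn h.contDiffOn

lemma coe_symm_coord {y : Euc N} (hy : y ∈ φ.source) (hyS : y ∈ S) :
    ((h.planeIsometry.symm (h.coord y) : P) : Euc N) = φ y := by
  rw [coord, LinearIsometryEquiv.symm_apply_apply]
  exact Submodule.starProjection_eq_self_iff.2 ((h.mem_iff y hy).1 hyS)

lemma coord_mem {y : Euc N} (hy : y ∈ φ.source) (hyS : y ∈ S) : h.coord y ∈ h.paramDomain := by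
  rw [paramDomain, Set.mem_ofPred_eq, h.coe_symm_coord hy hyS]
  exact φ.map_source hy

lemma param_coord {y : Euc N} (hy : y ∈ φ.source) (hyS : y ∈ S) : h.param (h.coord y) = y := by
  rw [param, h.coe_symm_coord hy hyS, φ.left_inv hy]

end IsFlatteningChart

namespace RectifiableVarifold

variable {V : RectifiableVarifold N n U}

/-- In a chart, sets over Lebesgue null sets of `ℝⁿ` have no weight. -/
lemma weight_coord_preimage_eq_zero (hU : IsOpen U)
    {φ : OpenPartialHomeomorph (Euc N) (Euc N)} {P : Submodule ℝ (Euc N)}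
    (h : IsFlatteningChart n V.reg φ P) {Z : Set (Euc n)} (hZ : volume Z = 0) :
    V.weight {x | x ∈ V.reg ∧ x ∈ φ.source ∧ h.coord x ∈ Z} = 0 := by
  refine measure_null_of_locally_null _ fun x hx => ?_
  obtain ⟨K, t, ht, hKt⟩ := ((h.contDiffOn_param.contDiffAt
    (h.isOpen_paramDomain.mem_nhds (h.coord_mem hx.2.1 hx.1))).of_le
      (by simp : (1 : ℕ∞ω) ≤ ∞)).exists_lipschitzOnWith
  have hcont : ContinuousAt h.coord x :=
    (h.contDiffOn_coord.contDiffAt (φ.open_source.mem_nhds hx.2.1)).continuousAt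
  obtain ⟨ε, hε, hball⟩ := Metric.nhds_basis_closedBall.mem_iff.1
    (inter_mem (inter_mem (hcont ht) (φ.open_source.mem_nhds hx.2.1))
      ((isOpen_chartDomain hU).mem_nhds (reg_subset_chartDomain hx.1)))
  have hcomp := V.isCompact_inter_reg (isCompact_closedBall x ε) fun y hy => (hball hy).2
  -- The parametrization is the inverse of `coord` on the regular set and is locally Lipschitz; `K +
  -- 1` replaces `K` to have a positive constant.
  refine ⟨(Metric.closedBall x ε ∩ V.reg) ∩ h.coord ⁻¹' Z, ?_,
    measure_inter_preimage_eq_zero hcomp.measurableSet ?_ ?_ (K := K + 1) (by positivity) ?_ ?_ hZ⟩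
  · filter_upwards [self_mem_nhdsWithin,
      mem_nhdsWithin_of_mem_nhds (Metric.closedBall_mem_nhds x hε)] with y hy hy'
    exact ⟨⟨hy', hy.1⟩, hy.2.2⟩
  · exact (V.weight_lt_top _ hcomp fun y hy =>
      chartDomain_subset (reg_subset_chartDomain hy.2)).ne
  · exact h.contDiffOn_coord.continuousOn.mono fun y hy => (hball hy.1).1.2
  · intro y hy y' hy'
    have := hKt.dist_le_mul _ (hball hy.1).1.1 _ (hball hy'.1).1.1
    rw [h.param_coord (hball hy.1).1.2 hy.2, h.param_coord (hball hy'.1).1.2 hy'.2] at this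
    refine this.trans (mul_le_mul_of_nonneg_right (by linarith) dist_nonneg)
  · filter_upwards [V.ae_tangent] with y hy hyB
    obtain ⟨P', θ, hP'⟩ := hy
    exact V.exists_weight_closedBall_le hU
      (chartDomain_subset (reg_subset_chartDomain hyB.2)) hP'

end RectifiableVarifold

/-! ### Locally Lipschitz functions -/

section Lipschitz

lemma locallyLipschitzOn_comp_contDiffOn {E F : Type*} [NormedAddCommGroup E] [NormedSpace ℝ E]
    [NormedAddCommGroup F] [NormedSpace ℝ F] {S : Set F} {D : Set E} {w : F → ℝ} {r : E → F}
    (hw : LocallyLipschitzOn S w) (hD : IsOpen D) (hr : ContDiffOn ℝ ∞ r D)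
    (hrS : Set.MapsTo r D S) : LocallyLipschitzOn D (w ∘ r) := by
  intro x hx
  obtain ⟨K, t, ht, hK⟩ := hw (hrS hx)
  have hrx := hr.contDiffAt (hD.mem_nhds hx)
  obtain ⟨K', t', ht', hK'⟩ :=
    (hrx.of_le (by simp : (1 : ℕ∞ω) ≤ ∞)).exists_lipschitzOnWith
  have h1 : Tendsto r (𝓝[D] x) (𝓝[S] (r x)) := tendsto_nhdsWithin_iff.2
    ⟨hrx.continuousAt.tendsto.mono_left nhdsWithin_le_nhds,
      eventually_mem_nhdsWithin.mono fun y hy => hrS hy⟩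
  exact ⟨K * K', r ⁻¹' t ∩ t', inter_mem (h1 ht) (mem_nhdsWithin_of_mem_nhds ht'),
    hK.comp (hK'.mono Set.inter_subset_right) fun y hy => hy.1⟩

lemma ae_differentiableAt_of_locallyLipschitzOn {g : Euc n → ℝ} {D : Set (Euc n)}
    (hD : IsOpen D) (hg : LocallyLipschitzOn D g) :
    volume {x | x ∈ D ∧ ¬ DifferentiableAt ℝ g x} = 0 := by
  refine measure_null_of_locally_null _ fun x hx => ?_
  obtain ⟨K, t, ht, hK⟩ := hg hx.1
  rw [hD.nhdsWithin_eq hx.1] at ht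
  obtain ⟨s, hst, hs, hxs⟩ := mem_nhds_iff.1 ht
  refine ⟨_, ?_, ae_iff.1 (hK.mono hst).ae_differentiableWithinAt_of_mem⟩
  filter_upwards [self_mem_nhdsWithin, mem_nhdsWithin_of_mem_nhds (hs.mem_nhds hxs)] with y hy hys
  intro h
  exact hy.2 ((h hys).differentiableAt (hs.mem_nhds hys))

lemma LocallyLipschitzOn.contDiff_mul {E : Type*} [NormedAddCommGroup E] [NormedSpace ℝ E]
    {D : Set E} {χ f : E → ℝ} (hD : IsOpen D) (hf : LocallyLipschitzOn D f)
    (hχ : ContDiff ℝ ∞ χ) (hχD : tsupport χ ⊆ D) : LocallyLipschitz fun x => χ x * f x := by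
  intro x
  by_cases hx : x ∈ D
  · obtain ⟨K, t, ht, hK⟩ := hf hx
    rw [hD.nhdsWithin_eq hx] at ht
    obtain ⟨K₁, t₁, ht₁, hK₁⟩ :=
      (hχ.contDiffAt.of_le (by simp : (1 : ℕ∞ω) ≤ ∞)).exists_lipschitzOnWith (x := x)
    have hmul : ContDiff ℝ 1 fun z : ℝ × ℝ => z.1 * z.2 := contDiff_fst.mul contDiff_snd
    obtain ⟨K₂, t₂, ht₂, hK₂⟩ := hmul.locallyLipschitz (χ x, f x)
    have hc : ContinuousAt (fun y => (χ y, f y)) x :=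
      hχ.continuous.continuousAt.prodMk (hK.continuousOn.continuousAt ht)
    refine ⟨_, _, inter_mem (inter_mem ht ht₁) (hc ht₂), hK₂.comp
      (g := fun z : ℝ × ℝ => z.1 * z.2) (f := fun y => (χ y, f y))
      ((hK₁.mono fun y hy => hy.1.2).prodMk (hK.mono fun y hy => hy.1.1)) fun y hy => hy.2⟩
  · refine ⟨0, (tsupport χ)ᶜ, (isClosed_tsupport χ).isOpen_compl.mem_nhds
      fun h => hx (hχD h), fun y hy z hz => ?_⟩
    simp [image_eq_zero_of_notMem_tsupport hy, image_eq_zero_of_notMem_tsupport hz]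

lemma LocallyLipschitz.finsetSum {E ι : Type*} [NormedAddCommGroup E] (s : Finset ι)
    {f : ι → E → ℝ} (hf : ∀ i, LocallyLipschitz (f i)) :
    LocallyLipschitz fun x => ∑ i ∈ s, f i x := by
  classical
  induction s using Finset.induction_on with
  | empty => simpa using LocallyLipschitz.const (0 : ℝ)
  | insert i s hi ih =>
    simp only [Finset.sum_insert hi]
    exact (hf i).add ih

/-- Pairs at distance at most `1` are controlled by compactness of the thickened support; for
distant pairs the oscillation `2 M` is at most `2 M` times the distance. -/
lemma LocallyLipschitz.exists_lipschitzWith {f : Euc N → ℝ} (hf : LocallyLipschitz f)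
    (hfc : HasCompactSupport f) : ∃ C, LipschitzWith C f := by
  obtain ⟨M, hM⟩ := hfc.exists_bound_of_continuous hf.continuous
  have hM0 : 0 ≤ M := (norm_nonneg _).trans (hM 0)
  obtain ⟨K, hK⟩ := (hf.locallyLipschitzOn (s := Metric.cthickening 1 (tsupport f))
    ).exists_lipschitzOnWith_of_compact (IsCompact.cthickening hfc)
  have key (x y : Euc N) (hx : x ∈ tsupport f) :
      dist (f x) (f y) ≤ (K + 2 * M) * dist x y := by
    rcases le_or_gt (dist x y) 1 with h | h
    · have hy : y ∈ Metric.cthickening 1 (tsupport f) :=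
        Metric.mem_cthickening_of_dist_le y x _ _ hx (by rwa [dist_comm])
      refine (hK.dist_le_mul x (Metric.self_subset_cthickening _ hx) y hy).trans ?_
      exact mul_le_mul_of_nonneg_right (by linarith) dist_nonneg
    · have h1 : dist (f x) (f y) ≤ 2 * M := by
        rw [dist_eq_norm]; linarith [norm_sub_le (f x) (f y), hM x, hM y]
      nlinarith [K.2, dist_nonneg (x := x) (y := y), mul_nonneg hM0 (sub_nonneg.2 h.le),
        mul_nonneg K.2 (dist_nonneg (x := x) (y := y))]
  refine ⟨K + 2 * ⟨M, hM0⟩, LipschitzWith.of_dist_le_mul fun x y => ?_⟩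
  by_cases hx : x ∈ tsupport f
  · exact key x y hx
  by_cases hy : y ∈ tsupport f
  · rw [dist_comm (f x), dist_comm x]; exact key y x hy
  · rw [image_eq_zero_of_notMem_tsupport hx, image_eq_zero_of_notMem_tsupport hy, dist_self]
    positivity

end Lipschitz

/-! ### Extension of Lipschitz functions from the regular set -/

namespace RectifiableVarifold

variable {V : RectifiableVarifold N n U} {w : Euc N → ℝ}

/-- The extension is `w ∘ param ∘ coord`. It is differentiable wherever `w ∘ param` is
differentiable at the coordinate, and Rademacher's exceptional set in `ℝⁿ` lifts to a set of weight
zero. -/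
lemma exists_local_extension (hU : IsOpen U) (hw : LocallyLipschitzOn V.reg w) {x : Euc N}
    (hx : x ∈ V.reg) :
    ∃ (D : Set (Euc N)) (f : Euc N → ℝ), IsOpen D ∧ x ∈ D ∧ D ⊆ V.chartDomain ∧
      Bornology.IsBounded D ∧ LocallyLipschitzOn D f ∧ (∀ y ∈ D ∩ V.reg, f y = w y) ∧
      ∀ᵐ y ∂V.weight, y ∈ D ∩ V.reg → DifferentiableAt ℝ f y := by
  obtain ⟨-, φ, P, hxφ, h'⟩ := reg_subset_chartDomain hx
  have h := h'.reg
  have hO : IsOpen (φ.source ∩ h.coord ⁻¹' h.paramDomain) :=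
    h.contDiffOn_coord.continuousOn.isOpen_inter_preimage φ.open_source h.isOpen_paramDomain
  have hg : LocallyLipschitzOn h.paramDomain (w ∘ h.param) :=
    locallyLipschitzOn_comp_contDiffOn hw h.isOpen_paramDomain h.contDiffOn_param h.mapsTo_param
  have hf : LocallyLipschitzOn (φ.source ∩ h.coord ⁻¹' h.paramDomain)
      ((w ∘ h.param) ∘ h.coord) :=
    locallyLipschitzOn_comp_contDiffOn hg hO
      (h.contDiffOn_coord.mono Set.inter_subset_left) fun y hy => hy.2
  refine ⟨(φ.source ∩ h.coord ⁻¹' h.paramDomain) ∩ (V.chartDomain ∩ Metric.ball x 1),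
    (w ∘ h.param) ∘ h.coord, hO.inter ((isOpen_chartDomain hU).inter Metric.isOpen_ball),
    ⟨⟨hxφ, h.coord_mem hxφ hx⟩, reg_subset_chartDomain hx, Metric.mem_ball_self one_pos⟩,
    fun y hy => hy.2.1, Metric.isBounded_ball.subset fun y hy => hy.2.2,
    hf.mono Set.inter_subset_left, fun y hy => ?_, ?_⟩
  · simp [h.param_coord hy.1.1.1 hy.2]
  · have hnull := weight_coord_preimage_eq_zero hU h
      (ae_differentiableAt_of_locallyLipschitzOn h.isOpen_paramDomain hg)
    filter_upwards [measure_eq_zero_iff_ae_notMem.1 hnull] with y hy hyD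
    have hdiff : DifferentiableAt ℝ (w ∘ h.param) (h.coord y) := by
      by_contra hcon
      exact hy ⟨hyD.2, hyD.1.1.1, hyD.1.1.2, hcon⟩
    exact hdiff.comp y ((h.contDiffOn_coord.contDiffAt
      (φ.open_source.mem_nhds hyD.1.1.1)).differentiableAt (by simp))

/-- A locally Lipschitz function with compact support in the regular set is the restriction of a
Lipschitz function on `ℝ^N` that is differentiable almost everywhere for the weight. -/
lemma exists_lipschitz_extension (hU : IsOpen U) (hw : LocallyLipschitzOn V.reg w)
    (hwc : HasCompactSupport w) (hwreg : tsupport w ⊆ V.reg) :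
    ∃ (f : Euc N → ℝ) (C : NNReal), LipschitzWith C f ∧ HasCompactSupport f ∧
      tsupport f ⊆ V.chartDomain ∧ (∀ y ∈ V.reg, f y = w y) ∧
      ∀ᵐ y ∂V.weight, y ∈ V.reg → DifferentiableAt ℝ f y := by
  choose! D f hDo hxD hDV hDb hfL hfw hfd using
    fun x (hx : x ∈ V.reg) => exists_local_extension hU hw hx
  obtain ⟨t, ht⟩ := hwc.isCompact.elim_finite_subcover (fun x : V.reg => D x)
    (fun x => hDo x x.2) fun x hx => Set.mem_iUnion.2 ⟨⟨x, hwreg hx⟩, hxD x (hwreg hx)⟩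
  obtain ⟨χ, hχ⟩ := SmoothPartitionOfUnity.exists_isSubordinate
    (modelWithCornersSelf ℝ (Euc N)) (isClosed_tsupport w) (fun x : t => D x)
    (fun x => hDo x x.1.2) (fun x hx => by
      obtain ⟨i, hi, hxi⟩ := Set.mem_iUnion₂.1 (ht hx)
      exact Set.mem_iUnion.2 ⟨⟨i, hi⟩, hxi⟩)
  have hχs (i : t) : ContDiff ℝ ∞ (χ i) := (χ i).contMDiff.contDiff
  have hχc (i : t) : IsCompact (tsupport (χ i)) :=
    Metric.isCompact_of_isClosed_isBounded (isClosed_tsupport _) ((hDb i i.1.2).subset (hχ i))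
  have hcK : IsCompact (⋃ i : t, tsupport (χ i)) := isCompact_iUnion hχc
  set F : Euc N → ℝ := fun x => ∑ i : t, χ i x * f i x with hF
  have hFK : tsupport F ⊆ ⋃ i : t, tsupport (χ i) := by
    refine closure_minimal (fun x hx => ?_) hcK.isClosed
    by_contra hcon
    refine hx (Finset.sum_eq_zero fun i _ => ?_)
    rw [image_eq_zero_of_notMem_tsupport fun h => hcon (Set.mem_iUnion.2 ⟨i, h⟩), zero_mul]
  have hFc : HasCompactSupport F := hcK.of_isClosed_subset (isClosed_tsupport _) hFK
  obtain ⟨C, hC⟩ := LocallyLipschitz.exists_lipschitzWith (LocallyLipschitz.finsetSum Finset.univ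
    fun i : t => LocallyLipschitzOn.contDiff_mul (hDo i i.1.2) (hfL i i.1.2) (hχs i) (hχ i)) hFc
  refine ⟨F, C, hC, hFc, hFK.trans (Set.iUnion_subset fun i => (hχ i).trans (hDV i i.1.2)),
    fun y hy => ?_, ?_⟩
  · have h1 (i : t) : χ i y * f i y = χ i y * w y := by
      by_cases hyi : y ∈ D i
      · rw [hfw i i.1.2 y ⟨hyi, hy⟩]
      · rw [image_eq_zero_of_notMem_tsupport fun h => hyi (hχ i h), zero_mul, zero_mul]
    rw [hF]
    simp only [h1, ← Finset.sum_mul]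
    by_cases hyw : y ∈ tsupport w
    · have := χ.sum_eq_one hyw
      rw [finsum_eq_sum_of_fintype] at this
      rw [this, one_mul]
    · rw [image_eq_zero_of_notMem_tsupport hyw, mul_zero]
  · have hall : ∀ᵐ y ∂V.weight, ∀ i : t, y ∈ D i ∩ V.reg → DifferentiableAt ℝ (f i) y :=
      ae_all_iff.2 fun i => hfd i i.1.2
    filter_upwards [hall] with y hy hyr
    refine DifferentiableAt.fun_sum fun i _ => ?_
    by_cases hyi : y ∈ D i
    · exact ((hχs i).differentiable (by simp) y).mul (hy i ⟨hyi, hyr⟩)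
    · refine (differentiableAt_const (0 : ℝ)).congr_of_eventuallyEq ?_
      filter_upwards [(isClosed_tsupport (χ i)).isOpen_compl.mem_nhds fun h => hyi (hχ i h)]
        with z hz
      rw [image_eq_zero_of_notMem_tsupport hz, zero_mul]

end RectifiableVarifold

/-! ### The inequality for Lipschitz functions -/

lemma IsTangentProjection.gradAt_eq {M O : Set (Euc N)} {p : Euc N → Euc N →L[ℝ] Euc N}
    (hp : IsTangentProjection M O p) {w f : Euc N → ℝ} {x : Euc N} (hx : x ∈ M ∩ O)
    (hwf : Set.EqOn w f M) (hf : DifferentiableAt ℝ f x) :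
    gradAt M w x = p x (gradient f x) := by
  rw [gradAt, hp.tanPart_eq hx]
  refine ext_inner_right ℝ fun v => ?_
  rw [hp.symm hx, hp.symm hx, inner_gradient_eq, InnerProductSpace.toDual_symm_apply]
  exact fderivWithin_apply_of_mem_tangentSpaceAt hx.1
    (Filter.mem_of_superset self_mem_nhdsWithin hwf) hf (hp.apply_mem hx v)

lemma gradAt_eq_zero_of_notMem_tsupport {M : Set (Euc N)} {w : Euc N → ℝ} {x : Euc N}
    (hx : x ∉ tsupport w) : gradAt M w x = 0 := by
  have h1 : w =ᶠ[𝓝 x] fun _ => 0 := notMem_tsupport_iff_eventuallyEq.1 hx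
  have : fderivWithin ℝ w M x = 0 := by
    rw [h1.fderivWithin_eq_of_nhds]; simp
  simp [gradAt, tanPart, this]

lemma norm_gradient_le {f : Euc N → ℝ} {C : NNReal} (hf : LipschitzWith C f) (x : Euc N) :
    ‖gradient f x‖ ≤ C := by
  rw [gradient, LinearIsometryEquiv.norm_map]
  exact norm_fderiv_le_of_lipschitz ℝ hf

lemma gaussian_le_one (x : Euc N) : Real.exp (-‖x‖ ^ 2 / 4) ≤ 1 :=
  Real.exp_le_one_iff.2 (by have := sq_nonneg ‖x‖; linarith)

end GaussianVarifold

end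

-- The smooth inequality is applied to the mollifications of the extension `f` and passed to the
-- limit. For `ε < δ` all supports lie in one compact `K` of finite weight, the values are bounded
-- by `B + C δ` and the tangential gradients by `C`, so dominated convergence applies to both sides.
open GaussianVarifold RectifiableVarifold in
theorem mainTheorem9 (N n : ℕ) (hn : n < N)
    (U : Set (GaussianVarifold.Euc N)) (hU : IsOpen U)
    (V : GaussianVarifold.RectifiableVarifold N n U)
    (hstat : V.IsFStationary) (hstab : V.IsGaussianStable)
    (w : GaussianVarifold.Euc N → ℝ) (hw : LocallyLipschitzOn V.reg w)
    (hwc : HasCompactSupport w) (hwreg : tsupport w ⊆ V.reg) :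
    ∫ x, w x ^ 2 * Real.exp (-‖x‖ ^ 2 / 4) ∂V.weight ≤
      2 * ∫ x, ‖GaussianVarifold.gradAt V.reg w x‖ ^ 2 * Real.exp (-‖x‖ ^ 2 / 4) ∂V.weight := by
  obtain ⟨f, C, hfL, hfc, hfV, hfw, hfd⟩ := exists_lipschitz_extension hU hw hwc hwreg
  obtain ⟨K, hK, hfK, hKV⟩ := exists_compact_between hfc (isOpen_chartDomain hU) hfV
  obtain ⟨O, p, hKO, hOV, hp⟩ := exists_isTangentProjection hU hK hKV
  obtain ⟨δ, hδ, hδK⟩ := hfc.isCompact.exists_cthickening_subset_open isOpen_interior hfK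
  obtain ⟨B, hB⟩ := hfc.exists_bound_of_continuous hfL.continuous
  have hKU : K ⊆ U := hKV.trans chartDomain_subset
  have hwf : tsupport w ⊆ tsupport f := closure_mono fun x hx => by
    rw [Function.mem_support, hfw x (hwreg (subset_tsupport w hx))]; exact hx
  have hfK' : tsupport f ⊆ K := hfK.trans interior_subset
  have hsmall : ∀ᶠ ε : ℝ in 𝓝[>] 0, 0 < ε ∧ ε < δ := Ioo_mem_nhdsGT hδ
  have hsupp {ε : ℝ} (hε : 0 < ε ∧ ε < δ) : tsupport (mollify f ε) ⊆ K :=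
    (tsupport_mollify_subset hε.1.le).trans
      ((Metric.cthickening_mono hε.2.le _).trans (hδK.trans interior_subset))
  have hu0 {ε : ℝ} (hε : 0 < ε ∧ ε < δ) {x : Euc N} (hx : x ∉ K) : mollify f ε x = 0 :=
    image_eq_zero_of_notMem_tsupport fun h => hx (hsupp hε h)
  have hg0 {ε : ℝ} (hε : 0 < ε ∧ ε < δ) {x : Euc N} (hx : x ∉ K) :
      gradient (mollify f ε) x = 0 := by
    have : fderiv ℝ (mollify f ε) x = 0 := image_eq_zero_of_notMem_tsupport
      fun h => hx (hsupp hε (tsupport_fderiv_subset ℝ h))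
    simp [gradient, this]
  have hbound (c : ℝ) : Integrable (K.indicator fun _ => c) V.weight :=
    (integrable_indicator_iff hK.measurableSet).2
      (integrableOn_const (V.weight_lt_top K hK hKU).ne)
  have hae : ∀ᵐ x ∂V.weight, x ∉ K ∨ x ∈ V.reg ∩ O ∧ DifferentiableAt ℝ f x := by
    filter_upwards [V.ae_mem_reg_of_mem_chartDomain, hfd] with x hx hxd
    by_cases hxK : x ∈ K
    · exact Or.inr ⟨⟨hx (hKV hxK), hKO hxK⟩, hxd (hx (hKV hxK))⟩
    · exact Or.inl hxK
  have hlim1 : Tendsto (fun ε => ∫ x, mollify f ε x ^ 2 * Real.exp (-‖x‖ ^ 2 / 4) ∂V.weight)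
      (𝓝[>] 0) (𝓝 (∫ x, w x ^ 2 * Real.exp (-‖x‖ ^ 2 / 4) ∂V.weight)) := by
    refine tendsto_integral_filter_of_dominated_convergence
      (K.indicator fun _ => (B + C * δ) ^ 2) ?_ ?_ (hbound _) ?_
    · filter_upwards [hsmall] with ε hε
      exact ((((contDiff_mollify hfL.continuous hε.1.ne').continuous).pow 2).mul
        continuous_gaussian).aestronglyMeasurable
    · filter_upwards [hsmall] with ε hε
      refine Eventually.of_forall fun x => ?_
      by_cases hx : x ∈ K
      · rw [Set.indicator_of_mem hx, Real.norm_of_nonneg (by positivity)]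
        have h1 : |mollify f ε x| ≤ B + C * δ := by
          have h2 := abs_mollify_sub_le hfL hε.1.le x
          have h3 : |f x| ≤ B := hB x
          have h4 : C * ε ≤ C * δ := mul_le_mul_of_nonneg_left hε.2.le C.2
          have h5 := abs_add_le (mollify f ε x - f x) (f x)
          rw [sub_add_cancel] at h5
          linarith
        rw [← sq_abs]
        exact (mul_le_of_le_one_right (by positivity) (gaussian_le_one x)).trans
          (pow_le_pow_left₀ (abs_nonneg _) h1 2)
      · simp [Set.indicator_of_notMem hx, hu0 hε hx]
    · filter_upwards [hae] with x hx
      rcases hx with hx | hx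
      · rw [image_eq_zero_of_notMem_tsupport fun h => hx (hfK' (hwf h))]
        refine tendsto_const_nhds.congr' ?_
        filter_upwards [hsmall] with ε hε
        rw [hu0 hε hx]
      · refine (Tendsto.pow ?_ 2).mul_const _
        rw [← hfw x hx.1.1, tendsto_iff_dist_tendsto_zero]
        refine squeeze_zero' (g := fun ε : ℝ => C * ε) (Eventually.of_forall fun _ => dist_nonneg)
          ?_ ?_
        · filter_upwards [hsmall] with ε hε
          exact abs_mollify_sub_le hfL hε.1.le x
        · exact ((continuous_const.mul continuous_id).tendsto' (0 : ℝ) 0 (by simp)).mono_left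
            nhdsWithin_le_nhds
  have hlim2 : Tendsto (fun ε => ∫ x, ‖p x (gradient (mollify f ε) x)‖ ^ 2 *
      Real.exp (-‖x‖ ^ 2 / 4) ∂V.weight) (𝓝[>] 0)
      (𝓝 (∫ x, ‖gradAt V.reg w x‖ ^ 2 * Real.exp (-‖x‖ ^ 2 / 4) ∂V.weight)) := by
    refine tendsto_integral_filter_of_dominated_convergence
      (K.indicator fun _ => (C : ℝ) ^ 2) ?_ ?_ (hbound _) ?_
    · filter_upwards [hsmall] with ε hε
      exact (((hp.contDiff.continuous.clm_apply (contDiff_gradient (contDiff_mollify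
        hfL.continuous hε.1.ne')).continuous).norm.pow 2).mul
        continuous_gaussian).aestronglyMeasurable
    · filter_upwards [hsmall] with ε hε
      filter_upwards [hae] with x hx
      rcases hx with hx | hx
      · simp [Set.indicator_of_notMem hx, hg0 hε hx]
      · by_cases hxK : x ∈ K
        · rw [Set.indicator_of_mem hxK, Real.norm_of_nonneg (by positivity),
            hp.eq_starProjection x hx.1]
          refine (mul_le_of_le_one_right (by positivity) (gaussian_le_one x)).trans
            (pow_le_pow_left₀ (norm_nonneg _) ?_ 2)
          exact (Submodule.norm_starProjection_apply_le _ _).trans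
            (norm_gradient_le (lipschitzWith_mollify hfL) x)
        · simp [Set.indicator_of_notMem hxK, hg0 hε hxK]
    · filter_upwards [hae] with x hx
      rcases hx with hx | hx
      · rw [gradAt_eq_zero_of_notMem_tsupport fun h => hx (hfK' (hwf h))]
        refine tendsto_const_nhds.congr' ?_
        filter_upwards [hsmall] with ε hε
        rw [hg0 hε hx, map_zero]
      -- Here weight-a.e. differentiability of `f` enters: at such points the full gradients of the
      -- mollifications converge, hence also their projections by `p x`.
      · rw [hp.gradAt_eq hx.1 (fun y hy => (hfw y hy).symm) hx.2]
        refine Tendsto.mul_const _ (Tendsto.pow (Tendsto.norm ?_) 2)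
        refine ((p x).continuous.tendsto _).comp ?_
        exact ((InnerProductSpace.toDual ℝ (Euc N)).symm.continuous.tendsto _).comp
          (tendsto_fderiv_mollify hfL hx.2)
  refine le_of_tendsto_of_tendsto hlim1 (hlim2.const_mul 2) ?_
  filter_upwards [hsmall] with ε hε
  exact integral_sq_le_of_contDiff hp hOV (contDiff_mollify hfL.continuous hε.1.ne')
    (hK.of_isClosed_subset (isClosed_tsupport _) (hsupp hε)) ((hsupp hε).trans hKO) hn hstat hstab
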